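/- Let $G$ be a finite group, $n=|G|$ and $\delta=\sqrt n$. Let $P_{2,-}=\mathbb C[G]$ be the group $C^*$-algebra ($g^*=g^{-1}$), with $\mathrm{tr}$ the (unnormalised) trace of the left regular representation, and let $P_{2,+}=\mathbb C^G$ be the $C^*$-algebra of functions on $G$, with $\mathrm{tr}(f)=\sum_{g}f(g)$. These are the 2-box spaces of the group subfactor planar algebra of $G$. The Fourier transforms $\mathcal F:P_{2,\mp}\to P_{2,\pm}$ are the linear bijections given by $g\mapsto\sqrt n\,\delta_g$ and $\sqrt n\,\delta_g\mapsto g^{-1}$, and the coproduct on either space is $a*b=\mathcal F(\mathcal F^{-1}(a)\,\mathcal F^{-1}(b))$. A projection $B$ is a biprojection if $\mathcal F(B)$ is a multiple of a projection. A projection $P$ is a right shift of $B$ if $\mathrm{tr}(P)=\mathrm{tr}(B)$ and $B*P=\frac{\mathrm{tr}(B)}{\delta}P$. An element $x\neq0$ of $P_{2,\pm}$ is a bi-shift of the biprojection $B\in P_{2,\pm}$ if $x=\mathcal F(Q)*(yP)$ for some right shift $P$ of $B$, some right shift $Q$ of the range projection of $\mathcal F(B)$, and some $y\in P_{2,\pm}$.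 (a) For every subgroup $H\le G$, every one-dimensional representation $\chi$ of $H$, every $g\in G$ and every $c\in\mathbb C\setminus\{0\}$, the element $x=c\sum_{h\in H}\chi(h)\,hg\in\mathbb C[G]$ is a bi-shift of a biprojection. Conversely, every bi-shift of a biprojection in $\mathbb C[G]$ is of this form. Likewise, the bi-shifts of biprojections in $\mathbb C^G$ are exactly the functions $c\sum_{h\in H}\chi(h)\,\delta_{hg}$ with $H,\chi,g,c$ as above. (b) The elements $x$ of the form in (a) are exactly the minimizers of the uncertainty principles for $G$: for $x\in\mathbb C[G]$, the element $x$ is of that form if and only if $x\ne0$ and $\mathcal S(x)\,\mathcal S(\mathcal F(x))=\delta^2$, where $\mathcal S$ is the trace of the range projection; and also if and only if $x\neq0$ and $$H(|x|^2)+H(|\mathcal F(x)|^2)=\|x\|_2^2\,(2\log\delta-4\log\|x\|_2),$$ where $H(|x|^2)=-\mathrm{tr}(|x|^2\log|x|^2)$ and $\|x\|_2=\mathrm{tr}(x^*x)^{1/2}$. -/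

import Mathlib

/-! The 2-box spaces of the group subfactor planar algebra of a finite group `G`:
`G → ℂ` (functions on `G`, pointwise operations) and `MonoidAlgebra ℂ G` (the group C⋆-algebra),
with their adjoints, unnormalised traces, Fourier transforms and coproducts. -/

noncomputable section

namespace GroupTwoBox

/-- The adjoint on the group algebra: the conjugate-linear extension of `g ↦ g⁻¹`. -/
instance groupAlgebraStarRing (G : Type*) [Group G] [Fintype G] :
    StarRing (MonoidAlgebra ℂ G) where
  star x := ∑ g : G, MonoidAlgebra.single g⁻¹ (star (x.coeff g))
  star_involutive x := by
    classical
    ext k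
    simp [MonoidAlgebra.coeff_sum, Finsupp.single_apply, inv_eq_iff_eq_inv]
  star_mul x y := by
    classical
    have key : ∀ z : MonoidAlgebra ℂ G,
        z = ∑ g : G, MonoidAlgebra.single g (z.coeff g) := fun z => by
      ext k
      simp [MonoidAlgebra.coeff_sum]
    have hc : ∀ k : G, (x * y).coeff k = ∑ a : G, ∑ b : G,
        if a * b = k then x.coeff a * y.coeff b else 0 := fun k => by
      conv_lhs => rw [key x, key y]
      simp only [Finset.sum_mul_sum, MonoidAlgebra.coeff_sum, MonoidAlgebra.single_mul_single,
        MonoidAlgebra.coeff_single, Finsupp.coe_finsetSum, Finset.sum_apply, Finsupp.single_apply]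
    ext k
    simp only [hc, Finset.sum_mul_sum, MonoidAlgebra.coeff_sum, MonoidAlgebra.single_mul_single,
      MonoidAlgebra.coeff_single, Finsupp.coe_finsetSum, Finset.sum_apply, Finsupp.single_apply]
    have h1 : ∀ f : G → ℂ, (∑ c : G, if c⁻¹ = k then f c else 0) = f k⁻¹ := fun f => by
      simp [inv_eq_iff_eq_inv]
    rw [h1, star_sum]
    conv_rhs => rw [Finset.sum_comm]
    refine Finset.sum_congr rfl fun a _ => ?_
    rw [star_sum]
    refine Finset.sum_congr rfl fun b _ => ?_
    have h2 : b⁻¹ * a⁻¹ = k ↔ a * b = k⁻¹ := by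
      rw [← mul_inv_rev, inv_eq_iff_eq_inv]
    simp only [h2, apply_ite star, star_zero, star_mul]
  star_add x y := by
    rw [← Finset.sum_add_distrib]
    exact Finset.sum_congr rfl fun g _ => by
      rw [MonoidAlgebra.coeff_add, Finsupp.add_apply, star_add, MonoidAlgebra.single_add]

/-- `δ = √|G|`, the value of a closed string. -/
def delta (G : Type*) [Fintype G] : ℝ := Real.sqrt (Fintype.card G)

lemma delta_ne_zero (G : Type*) [Group G] [Fintype G] : ((delta G : ℝ) : ℂ) ≠ 0 := by
  have h : 0 < delta G := Real.sqrt_pos.2 (by exact_mod_cast Fintype.card_pos)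
  exact_mod_cast h.ne'

/-- The unnormalised trace on functions: integration against the counting measure. -/
def funTrace (G : Type*) [Fintype G] : (G → ℂ) →ₗ[ℂ] ℂ where
  toFun f := ∑ g, f g
  map_add' f f' := by simp [Finset.sum_add_distrib]
  map_smul' c f := by simp [Finset.mul_sum]

/-- The unnormalised trace on the group algebra: the trace in the left regular representation. -/
def algTrace (G : Type*) [Group G] [Fintype G] : MonoidAlgebra ℂ G →ₗ[ℂ] ℂ :=
  (LinearMap.trace ℂ (MonoidAlgebra ℂ G)).comp (LinearMap.mul ℂ (MonoidAlgebra ℂ G))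

/-- The Fourier transform from the group algebra to functions: `g ↦ √|G| δ_g`. -/
def fourierAlg (G : Type*) [Group G] [Fintype G] : MonoidAlgebra ℂ G ≃ₗ[ℂ] (G → ℂ) where
  toFun x g := (delta G : ℂ) * x.coeff g
  map_add' x y := by
    ext g
    simp [mul_add]
  map_smul' c x := by
    ext g
    simp [mul_left_comm]
  invFun f := ∑ g : G, MonoidAlgebra.single g ((delta G : ℂ)⁻¹ * f g)
  left_inv x := by
    classical
    have h := delta_ne_zero G
    ext k
    simp [MonoidAlgebra.coeff_sum, h]
  right_inv f := by
    classical
    have h := delta_ne_zero G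
    ext k
    simp [MonoidAlgebra.coeff_sum, Finsupp.single_apply, h]

/-- The Fourier transform from functions to the group algebra: `√|G| δ_g ↦ g⁻¹`. -/
def fourierFun (G : Type*) [Group G] [Fintype G] : (G → ℂ) ≃ₗ[ℂ] MonoidAlgebra ℂ G where
  toFun f := ∑ g : G, MonoidAlgebra.single g⁻¹ ((delta G : ℂ)⁻¹ * f g)
  map_add' f f' := by
    simp [mul_add, MonoidAlgebra.single_add, Finset.sum_add_distrib]
  map_smul' c f := by
    simp [Finset.smul_sum, MonoidAlgebra.smul_single, mul_left_comm]
  invFun x g := (delta G : ℂ) * x.coeff g⁻¹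
  left_inv f := by
    classical
    have h := delta_ne_zero G
    ext k
    simp [MonoidAlgebra.coeff_sum, Finsupp.single_apply, h]
  right_inv x := by
    classical
    have h := delta_ne_zero G
    ext k
    simp [MonoidAlgebra.coeff_sum, Finsupp.single_apply, h, inv_eq_iff_eq_inv]

section General

/-! In this section `A` is one of the two 2-box spaces and `A'` is the other one;
`F : A ≃ₗ A'` and `F' : A' ≃ₗ A` are the two Fourier transforms, `tr` and `tr'` the two traces. -/

variable {A A' : Type*} [Ring A] [StarRing A] [Algebra ℂ A] [Ring A'] [StarRing A'] [Algebra ℂ A']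

/-- The coproduct `a * b = F' (F'⁻¹ a · F'⁻¹ b)` on `A`. -/
def coproduct (F' : A' ≃ₗ[ℂ] A) (a b : A) : A := F' (F'.symm a * F'.symm b)

/-- `p` is the range projection of `a`: the smallest projection with `p a = a`. -/
structure IsRangeProjection (p a : A) : Prop where
  proj : IsStarProjection p
  mul_eq : p * a = a
  le : ∀ q : A, IsStarProjection q → q * a = a → q * p = p

/-- `B` is a biprojection: a projection whose Fourier transform is a multiple of a projection. -/
def IsBiprojection (F : A ≃ₗ[ℂ] A') (B : A) : Prop :=
  IsStarProjection B ∧ ∃ (c : ℂ) (p : A'), IsStarProjection p ∧ F B = c • p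

/-- The projection `p` is a right shift of `B`: `tr p = tr B` and `B * p = (tr B / δ) p`, where
the last `*` is the coproduct. -/
def IsRightShift (F' : A' ≃ₗ[ℂ] A) (tr : A →ₗ[ℂ] ℂ) (δ : ℝ) (p B : A) : Prop :=
  IsStarProjection p ∧ tr p = tr B ∧ coproduct F' B p = (tr B / (δ : ℂ)) • p

/-- `x` is a bi-shift of a biprojection `B`: it is nonzero and equals the coproduct of `F' Q` and
`y P`, for a right shift `P` of `B`, a right shift `Q` of the range projection of `F B`,
and some element `y`. -/
def IsBishift (F : A ≃ₗ[ℂ] A') (F' : A' ≃ₗ[ℂ] A) (tr : A →ₗ[ℂ] ℂ) (tr' : A' →ₗ[ℂ] ℂ) (δ : ℝ)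
    (x : A) : Prop :=
  x ≠ 0 ∧ ∃ B : A, IsBiprojection F B ∧
    ∃ B' : A', IsRangeProjection B' (F B) ∧
      ∃ P : A, IsRightShift F' tr δ P B ∧
        ∃ Q : A', IsRightShift F tr' δ Q B' ∧
          ∃ y : A, x = coproduct F' (F' Q) (y * P)

/-- The 2-norm `‖x‖₂ = tr(x⋆ x)^(1/2)`. -/
def norm2 (tr : A →ₗ[ℂ] ℂ) (x : A) : ℝ := Real.sqrt (tr (star x * x)).re

end General

variable {G : Type*} [Group G] [Fintype G]

/-- An element of the group algebra is a bi-shift of a biprojection. -/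
def IsAlgBishift (x : MonoidAlgebra ℂ G) : Prop :=
  IsBishift (fourierAlg G) (fourierFun G) (algTrace G) (funTrace G) (delta G) x

/-- A function on the group is a bi-shift of a biprojection. -/
def IsFunBishift (f : G → ℂ) : Prop :=
  IsBishift (fourierFun G) (fourierAlg G) (funTrace G) (algTrace G) (delta G) f

/-- The nonzero element `x` attains equality in the Donoho-Stark uncertainty principle
`S(x) S(F x) ≥ δ²`, where `S` is the trace of the range projection. -/
def IsDonohoStarkMinimizer (x : MonoidAlgebra ℂ G) : Prop :=
  x ≠ 0 ∧ ∃ (p : MonoidAlgebra ℂ G) (q : G → ℂ),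
    IsRangeProjection p x ∧ IsRangeProjection q (fourierAlg G x) ∧
      algTrace G p * funTrace G q = (delta G : ℂ) ^ 2

/-- The matrix of left multiplication by `x` with respect to the orthonormal basis of group
elements of `ℓ²(G)`. -/
def leftRegular (x : MonoidAlgebra ℂ G) : Matrix G G ℂ :=
  Matrix.of fun a b => x.coeff (a * b⁻¹)

open scoped Classical in
/-- The von Neumann entropy `H(|x|²) = -tr(|x|² log |x|²)` in the group algebra; the trace is that
of the left regular representation, so this is the sum of `-t log t` over the eigenvalues `t`
of `|x|² = x⋆ x` there. -/
def algEntropy (x : MonoidAlgebra ℂ G) : ℝ :=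
  ∑ i, Real.negMulLog
    ((Matrix.isHermitian_conjTranspose_mul_self (leftRegular x)).eigenvalues i)

/-- The entropy `H(|f|²) = -∑ |f(g)|² log |f(g)|²` of a function. -/
def funEntropy (f : G → ℂ) : ℝ := ∑ g, Real.negMulLog (‖f g‖ ^ 2)

/-- The nonzero element `x` attains equality in the Hirschman-Beckner uncertainty principle
`H(|x|²) + H(|F x|²) ≥ ‖x‖₂² (2 log δ - 4 log ‖x‖₂)`. -/
def IsHirschmanBecknerMinimizer (x : MonoidAlgebra ℂ G) : Prop :=
  x ≠ 0 ∧ algEntropy x + funEntropy (fourierAlg G x) =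
    norm2 (algTrace G) x ^ 2 *
      (2 * Real.log (delta G) - 4 * Real.log (norm2 (algTrace G) x))

open scoped Classical in
/-- The element `∑_{h ∈ H} χ(h) hg` of the group algebra, for a one-dimensional representation `χ`
of the subgroup `H`. -/
def cosetElement (H : Subgroup G) (χ : H →* ℂˣ) (g : G) : MonoidAlgebra ℂ G :=
  ∑ h : H, MonoidAlgebra.single ((h : G) * g) (χ h : ℂ)

open scoped Classical in
/-- The function `∑_{h ∈ H} χ(h) δ_{hg}` on the group. -/
def cosetFunction (H : Subgroup G) (χ : H →* ℂˣ) (g : G) : G → ℂ :=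
  ∑ h : H, Pi.single ((h : G) * g) (χ h : ℂ)

end GroupTwoBox

end

namespace GroupTwoBox

section Coefficients

lemma ext_coeff {G : Type*} {x y : MonoidAlgebra ℂ G} (h : ∀ k, x.coeff k = y.coeff k) : x = y :=
  MonoidAlgebra.coeff_injective (Finsupp.ext h)

lemma funTrace_apply {G : Type*} [Fintype G] (f : G → ℂ) : funTrace G f = ∑ g, f g := rfl

variable {G : Type*} [Group G] [Fintype G]

lemma coeff_mul_eq_sum (x y : MonoidAlgebra ℂ G) (k : G) :
    (x * y).coeff k = ∑ a, x.coeff a * y.coeff (a⁻¹ * k) := by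
  rw [MonoidAlgebra.coeff_mul_apply_left, Finsupp.sum_fintype]
  simp

lemma coeff_star (x : MonoidAlgebra ℂ G) (k : G) :
    (star x).coeff k = star (x.coeff k⁻¹) := by
  classical
  change (∑ g : G, MonoidAlgebra.single g⁻¹ (star (x.coeff g))).coeff k = _
  simp [MonoidAlgebra.coeff_sum, Finsupp.single_apply, inv_eq_iff_eq_inv]

lemma star_smul_eq (c : ℂ) (x : MonoidAlgebra ℂ G) : star (c • x) = star c • star x :=
  ext_coeff fun k => by simp [coeff_star]

lemma star_single_one (g : G) :
    star (MonoidAlgebra.single g (1 : ℂ)) = MonoidAlgebra.single g⁻¹ 1 := by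
  classical
  refine ext_coeff fun k => ?_
  rw [coeff_star, MonoidAlgebra.coeff_single, MonoidAlgebra.coeff_single,
    Finsupp.single_apply, Finsupp.single_apply, apply_ite star, star_one, star_zero]
  exact if_congr inv_eq_iff_eq_inv.symm rfl rfl

lemma algTrace_apply (x : MonoidAlgebra ℂ G) :
    algTrace G x = (Fintype.card G : ℂ) * x.coeff 1 := by
  classical
  rw [algTrace, LinearMap.comp_apply, LinearMap.trace_eq_matrix_trace ℂ (MonoidAlgebra.basis G ℂ),
    Matrix.trace]
  have h : ∀ g : G, (MonoidAlgebra.basis G ℂ).repr (x * MonoidAlgebra.single g 1) g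
      = x.coeff 1 := fun g => by
    change (x * MonoidAlgebra.single g 1).coeff g = _
    simp
  simp [LinearMap.toMatrix_apply, h]

lemma delta_sq (G : Type*) [Group G] [Fintype G] :
    (delta G : ℂ) ^ 2 = (Fintype.card G : ℂ) := by
  rw [← Complex.ofReal_pow, delta, Real.sq_sqrt (by positivity)]
  simp

lemma fourierAlg_apply (x : MonoidAlgebra ℂ G) (k : G) :
    fourierAlg G x k = (delta G : ℂ) * x.coeff k := rfl

lemma fourierFun_coeff (f : G → ℂ) (k : G) :
    (fourierFun G f).coeff k = (delta G : ℂ)⁻¹ * f k⁻¹ := by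
  classical
  change (∑ g : G, MonoidAlgebra.single g⁻¹ ((delta G : ℂ)⁻¹ * f g)).coeff k = _
  simp [MonoidAlgebra.coeff_sum, Finsupp.single_apply, inv_eq_iff_eq_inv]

lemma fourierFun_symm_apply (x : MonoidAlgebra ℂ G) (k : G) :
    (fourierFun G).symm x k = (delta G : ℂ) * x.coeff k⁻¹ := rfl

lemma fourierAlg_symm_coeff (f : G → ℂ) (k : G) :
    ((fourierAlg G).symm f).coeff k = (delta G : ℂ)⁻¹ * f k := by
  classical
  change (∑ g : G, MonoidAlgebra.single g ((delta G : ℂ)⁻¹ * f g)).coeff k = _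
  simp [MonoidAlgebra.coeff_sum, Finsupp.single_apply]

/-- The coproduct on the group algebra is the rescaled pointwise product of coefficients. -/
lemma coproduct_alg_coeff (a b : MonoidAlgebra ℂ G) (k : G) :
    (coproduct (fourierFun G) a b).coeff k = (delta G : ℂ) * (a.coeff k * b.coeff k) := by
  have h := delta_ne_zero G
  simp only [coproduct, fourierFun_coeff, Pi.mul_apply, fourierFun_symm_apply, inv_inv]
  field_simp

/-- The coproduct on functions is the rescaled convolution. -/
lemma coproduct_fun_apply (a b : G → ℂ) (k : G) :
    coproduct (fourierAlg G) a b k = (delta G : ℂ)⁻¹ * ∑ g, a g * b (g⁻¹ * k) := by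
  have h := delta_ne_zero G
  simp only [coproduct, fourierAlg_apply, coeff_mul_eq_sum, fourierAlg_symm_coeff, Finset.mul_sum]
  refine Finset.sum_congr rfl fun g _ => ?_
  field_simp

end Coefficients

section Projections

variable {G : Type*} [Group G] [Fintype G] {p : MonoidAlgebra ℂ G}

lemma projection_coeff_inv (hp : IsStarProjection p) (k : G) :
    p.coeff k⁻¹ = star (p.coeff k) := by
  have h := coeff_star p k⁻¹
  rwa [hp.isSelfAdjoint.star_eq, inv_inv] at h

lemma sum_star_mul_translate (hp : IsStarProjection p) (h : G) :
    ∑ k, star (p.coeff k) * p.coeff (k * h) = p.coeff h := by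
  conv_rhs => rw [← hp.isIdempotentElem.eq, coeff_mul_eq_sum]
  rw [← Equiv.sum_comp (Equiv.inv G)]
  refine Finset.sum_congr rfl fun k _ => ?_
  rw [Equiv.inv_apply, projection_coeff_inv hp, star_star]

lemma sum_normSq_projection (hp : IsStarProjection p) :
    ∑ k, ‖p.coeff k‖ ^ 2 = (p.coeff 1).re := by
  have h := congrArg Complex.re (sum_star_mul_translate hp 1)
  rw [← h, Complex.re_sum]
  refine Finset.sum_congr rfl fun k _ => ?_
  rw [mul_one, Complex.star_def, mul_comm, Complex.mul_conj, Complex.ofReal_re,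
    Complex.normSq_eq_norm_sq]

lemma projection_coeff_one (hp : IsStarProjection p) :
    p.coeff 1 = ((p.coeff 1).re : ℂ) := by
  have h := projection_coeff_inv hp 1
  rw [inv_one] at h
  exact (Complex.conj_eq_iff_re.1 h.symm).symm

lemma projection_coeff_one_nonneg (hp : IsStarProjection p) : 0 ≤ (p.coeff 1).re := by
  rw [← sum_normSq_projection hp]
  positivity

lemma norm_projection_coeff_one (hp : IsStarProjection p) :
    ‖p.coeff 1‖ = (p.coeff 1).re := by
  rw [projection_coeff_one hp, Complex.norm_real, Real.norm_eq_abs, Complex.ofReal_re,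
    abs_of_nonneg (projection_coeff_one_nonneg hp)]

lemma projection_eq_zero (hp : IsStarProjection p) (h : p.coeff 1 = 0) : p = 0 := by
  have h1 := sum_normSq_projection hp
  rw [h, Complex.zero_re, Finset.sum_eq_zero_iff_of_nonneg fun _ _ => by positivity] at h1
  exact ext_coeff fun k => by simpa using h1 k (Finset.mem_univ k)

lemma sum_normSq_translate_sub (hp : IsStarProjection p) (h : G) :
    ∑ k, ‖p.coeff (k * h) * p.coeff 1 - p.coeff k * p.coeff h‖ ^ 2 =
      (p.coeff 1).re * ((p.coeff 1).re ^ 2 - ‖p.coeff h‖ ^ 2) := by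
  have key : (∑ k, (p.coeff (k * h) * p.coeff 1 - p.coeff k * p.coeff h) *
      star (p.coeff (k * h) * p.coeff 1 - p.coeff k * p.coeff h)) =
      p.coeff 1 * (p.coeff 1 ^ 2 - p.coeff h * star (p.coeff h)) := by
    have e1 : star (p.coeff 1) = p.coeff 1 := by
      simpa using (projection_coeff_inv hp 1).symm
    have s1 : ∑ k, p.coeff k * star (p.coeff k) = p.coeff 1 := by
      rw [← sum_star_mul_translate hp 1]
      exact Finset.sum_congr rfl fun k _ => by rw [mul_one, mul_comm]
    have s2 : ∑ k, p.coeff (k * h) * star (p.coeff (k * h)) = p.coeff 1 := by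
      rw [← s1]
      exact Equiv.sum_comp (Equiv.mulRight h) fun k => p.coeff k * star (p.coeff k)
    have s3 := sum_star_mul_translate hp h
    have s4 : ∑ k, p.coeff k * star (p.coeff (k * h)) = star (p.coeff h) := by
      conv_rhs => rw [← s3, star_sum]
      exact Finset.sum_congr rfl fun k _ => by rw [star_mul, star_star, mul_comm]
    calc _ = ∑ k, (p.coeff 1 ^ 2 * (p.coeff (k * h) * star (p.coeff (k * h)))
          - p.coeff 1 * star (p.coeff h) * (star (p.coeff k) * p.coeff (k * h))
          - p.coeff 1 * p.coeff h * (p.coeff k * star (p.coeff (k * h)))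
          + p.coeff h * star (p.coeff h) * (p.coeff k * star (p.coeff k))) := by
          refine Finset.sum_congr rfl fun k _ => ?_
          rw [star_sub, star_mul, star_mul, e1]
          ring
      _ = _ := by
          rw [Finset.sum_add_distrib, Finset.sum_sub_distrib, Finset.sum_sub_distrib,
            ← Finset.mul_sum, ← Finset.mul_sum, ← Finset.mul_sum, ← Finset.mul_sum, s1, s2, s3, s4]
          ring
  have e := projection_coeff_one hp
  rw [e] at key
  apply Complex.ofReal_injective
  simp only [Complex.star_def, Complex.mul_conj, Complex.normSq_eq_norm_sq] at key
  rw [e]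
  push_cast at key ⊢
  simpa using key

lemma norm_projection_coeff_le (hp : IsStarProjection p) (h : G) :
    ‖p.coeff h‖ ≤ ‖p.coeff 1‖ := by
  by_cases h0 : p.coeff 1 = 0
  · simp [projection_eq_zero hp h0]
  have hpos : 0 < (p.coeff 1).re := by
    rw [← norm_projection_coeff_one hp]
    exact norm_pos_iff.2 h0
  have h1 : 0 ≤ (p.coeff 1).re * ((p.coeff 1).re ^ 2 - ‖p.coeff h‖ ^ 2) := by
    rw [← sum_normSq_translate_sub hp h]
    positivity
  have h2 := nonneg_of_mul_nonneg_right h1 hpos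
  rw [norm_projection_coeff_one hp]
  exact le_of_sq_le_sq (by linarith) hpos.le

lemma projection_coeff_mul (hp : IsStarProjection p) {h : G} (hh : ‖p.coeff h‖ = ‖p.coeff 1‖)
    (k : G) : p.coeff (k * h) * p.coeff 1 = p.coeff k * p.coeff h := by
  have h1 := sum_normSq_translate_sub hp h
  rw [hh, norm_projection_coeff_one hp, sub_self, mul_zero,
    Finset.sum_eq_zero_iff_of_nonneg fun _ _ => by positivity] at h1
  simpa [sub_eq_zero] using h1 k (Finset.mem_univ k)

/-- The coefficients of a projection in the group algebra of maximal modulus are carried by a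
subgroup, on which they are proportional to a character. -/
lemma exists_character_of_projection (hp : IsStarProjection p) (h0 : p.coeff 1 ≠ 0) :
    ∃ (H : Subgroup G) (χ : H →* ℂˣ), (∀ k, k ∈ H ↔ ‖p.coeff k‖ = ‖p.coeff 1‖) ∧
      (∀ h : H, p.coeff h = χ h * p.coeff 1) ∧ (Nat.card H : ℝ) * ‖p.coeff 1‖ ≤ 1 := by
  classical
  have hn : ‖p.coeff 1‖ ≠ 0 := norm_ne_zero_iff.2 h0
  let H : Subgroup G :=
    { carrier := {k | ‖p.coeff k‖ = ‖p.coeff 1‖}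
      mul_mem' := fun {a b} ha hb => by
        have h := congrArg norm (projection_coeff_mul hp hb a)
        rw [norm_mul, norm_mul, Set.mem_ofPred.1 ha, Set.mem_ofPred.1 hb] at h
        exact mul_right_cancel₀ hn h
      one_mem' := rfl
      inv_mem' := fun {a} ha => by
        change ‖p.coeff a⁻¹‖ = _
        rw [projection_coeff_inv hp, norm_star]
        exact ha }
  have hmem : ∀ k, k ∈ H ↔ ‖p.coeff k‖ = ‖p.coeff 1‖ := fun k => Iff.rfl
  let φ : H →* ℂ :=
    { toFun := fun h => p.coeff h / p.coeff 1
      map_one' := by simp [h0]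
      map_mul' := fun a b => by
        have h := projection_coeff_mul hp ((hmem b).1 b.2) a
        rw [Subgroup.coe_mul]
        field_simp
        exact h }
  refine ⟨H, φ.toHomUnits, hmem, fun h => ?_, ?_⟩
  · rw [MonoidHom.coe_toHomUnits]
    change _ = p.coeff h / p.coeff 1 * p.coeff 1
    field_simp
  · have h1 := sum_normSq_projection hp
    rw [← norm_projection_coeff_one hp] at h1
    have h2 : ∑ k ∈ Finset.univ.filter (· ∈ H), ‖p.coeff k‖ ^ 2 ≤ ‖p.coeff 1‖ := by
      rw [← h1]
      exact Finset.sum_le_sum_of_subset_of_nonneg (Finset.filter_subset _ _)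
        fun _ _ _ => by positivity
    rw [Finset.sum_congr rfl fun k hk => by rw [(hmem k).1 (Finset.mem_filter.1 hk).2],
      Finset.sum_const, nsmul_eq_mul, ← Fintype.card_subtype, ← Nat.card_eq_fintype_card] at h2
    have h3 : 0 < ‖p.coeff 1‖ := norm_pos_iff.2 h0
    have h4 : (Nat.card H : ℝ) * ‖p.coeff 1‖ ^ 2 ≤ ‖p.coeff 1‖ := h2
    nlinarith

end Projections

section Cosets

variable {G : Type*} [Group G] [Fintype G] (H : Subgroup G) (χ : H →* ℂˣ)

lemma cosetFunction_mul (h : H) (g : G) : cosetFunction H χ g (h * g) = χ h := by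
  classical
  rw [cosetFunction, Finset.sum_apply, Finset.sum_eq_single h]
  · simp
  · intro b _ hb
    rw [Pi.single_eq_of_ne]
    simpa [eq_comm] using hb
  · simp

lemma cosetFunction_of_notMem {g k : G} (hk : k * g⁻¹ ∉ H) : cosetFunction H χ g k = 0 := by
  classical
  rw [cosetFunction, Finset.sum_apply]
  refine Finset.sum_eq_zero fun b _ => ?_
  rw [Pi.single_eq_of_ne]
  rintro rfl
  exact hk (by simp)

lemma cosetFunction_of_mem {g k : G} (hk : k * g⁻¹ ∈ H) :
    cosetFunction H χ g k = χ ⟨k * g⁻¹, hk⟩ := by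
  have h := cosetFunction_mul H χ ⟨k * g⁻¹, hk⟩ g
  simpa using h

lemma cosetFunction_one_coe (h : H) : cosetFunction H χ 1 h = χ h := by
  simpa using cosetFunction_mul H χ h 1

lemma cosetFunction_eq_translate (g k : G) :
    cosetFunction H χ g k = cosetFunction H χ 1 (k * g⁻¹) := by
  by_cases hk : k * g⁻¹ ∈ H
  · rw [cosetFunction_of_mem H χ hk, ← cosetFunction_one_coe]
  · rw [cosetFunction_of_notMem H χ hk, cosetFunction_of_notMem]
    simpa using hk

lemma cosetFunction_ne_zero {g k : G} : cosetFunction H χ g k ≠ 0 ↔ k * g⁻¹ ∈ H := by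
  refine ⟨fun h => ?_, fun h => ?_⟩
  · by_contra hk
    exact h (cosetFunction_of_notMem H χ hk)
  · rw [cosetFunction_of_mem H χ h]
    exact Units.ne_zero _

lemma cosetFunction_trivial_of_mem {g k : G} (hk : k * g⁻¹ ∈ H) :
    cosetFunction H 1 g k = 1 := by
  rw [cosetFunction_of_mem H 1 hk]
  simp

lemma cosetElement_coeff (g k : G) : (cosetElement H χ g).coeff k = cosetFunction H χ g k := by
  classical
  rw [cosetElement, cosetFunction, MonoidAlgebra.coeff_sum, Finsupp.finsetSum_apply,
    Finset.sum_apply]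
  refine Finset.sum_congr rfl fun h _ => ?_
  rw [MonoidAlgebra.coeff_single, Finsupp.single_apply, Pi.single_apply]
  simp [eq_comm]

/-- Conjugating a character moves left cosets to right cosets. -/
lemma exists_conj_cosetFunction (g : G) : ∃ (K : Subgroup G) (ψ : K →* ℂˣ),
    ∀ k, cosetFunction K ψ 1 (g⁻¹ * k * g) = cosetFunction H χ 1 k := by
  have hmem : ∀ k, k ∈ H.map (MulAut.conj g⁻¹).toMonoidHom ↔ g * k * g⁻¹ ∈ H := fun k => by
    rw [Subgroup.mem_map_equiv]
    simp
  let e : H.map (MulAut.conj g⁻¹).toMonoidHom →* H :=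
    { toFun := fun k => ⟨g * k * g⁻¹, (hmem k).1 k.2⟩
      map_one' := by ext; simp
      map_mul' := fun a b => by
        ext
        change g * (a * b : G) * g⁻¹ = g * a * g⁻¹ * (g * b * g⁻¹)
        group }
  refine ⟨H.map (MulAut.conj g⁻¹).toMonoidHom, χ.comp e, fun k => ?_⟩
  · by_cases hk : k ∈ H
    · have h1 : g⁻¹ * k * g * (1 : G)⁻¹ ∈ H.map (MulAut.conj g⁻¹).toMonoidHom := by
        rw [hmem]
        simpa [mul_assoc] using hk
      have h2 : k * (1 : G)⁻¹ ∈ H := by simpa using hk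
      rw [cosetFunction_of_mem _ _ h1, cosetFunction_of_mem _ _ h2, MonoidHom.comp_apply]
      congr 2
      ext
      change g * (g⁻¹ * k * g * 1⁻¹) * g⁻¹ = k * 1⁻¹
      group
    · rw [cosetFunction_of_notMem, cosetFunction_of_notMem]
      · simpa using hk
      · rw [hmem]
        simpa [mul_assoc] using hk

lemma norm_character (h : H) : ‖(χ h : ℂ)‖ = 1 := by
  have h1 : (χ h : ℂ) ^ Nat.card H = 1 := by
    rw [← Units.val_pow_eq_pow_val, ← map_pow, pow_card_eq_one', map_one, Units.val_one]
  exact Complex.norm_eq_one_of_pow_eq_one h1 Nat.card_pos.ne'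

lemma star_character (h : H) : star (χ h : ℂ) = (χ h⁻¹ : ℂ) := by
  rw [map_inv, Units.val_inv_eq_inv_val, Complex.inv_def, Complex.normSq_eq_norm_sq,
    norm_character, Complex.star_def]
  simp

lemma cosetElement_eq_mul_single (g : G) :
    cosetElement H χ g = cosetElement H χ 1 * MonoidAlgebra.single g 1 := by
  simp only [cosetElement, Finset.sum_mul, MonoidAlgebra.single_mul_single, mul_one]

lemma cosetElement_mul_self :
    cosetElement H χ 1 * cosetElement H χ 1 = (Nat.card H : ℂ) • cosetElement H χ 1 := by
  classical
  have h1 : ∀ h : H, MonoidAlgebra.single (h : G) (χ h : ℂ) * cosetElement H χ 1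
      = cosetElement H χ 1 := fun h => by
    simp only [cosetElement, Finset.mul_sum, MonoidAlgebra.single_mul_single, mul_one]
    rw [← Equiv.sum_comp (Equiv.mulLeft h) fun k : H => MonoidAlgebra.single (k : G) (χ k : ℂ)]
    exact Finset.sum_congr rfl fun k _ => by simp
  conv_lhs =>
    enter [1]
    rw [cosetElement]
  simp only [mul_one, Finset.sum_mul, h1]
  simp [Nat.cast_smul_eq_nsmul]

lemma star_cosetElement : star (cosetElement H χ 1) = cosetElement H χ 1 := by
  refine ext_coeff fun k => ?_
  rw [coeff_star, cosetElement_coeff, cosetElement_coeff]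
  by_cases hk : k ∈ H
  · have h1 := cosetFunction_one_coe H χ ⟨k, hk⟩
    have h2 := cosetFunction_one_coe H χ ⟨k, hk⟩⁻¹
    rw [← star_character, ← h1] at h2
    rw [← star_star (cosetFunction H χ 1 k), ← h2]
    rfl
  · rw [cosetFunction_of_notMem, cosetFunction_of_notMem, star_zero] <;> simpa using hk

/-- The projection onto the isotypic component of the one-dimensional representation `χ⁻¹` of
`H`. -/
noncomputable def characterProjection : MonoidAlgebra ℂ G := (Nat.card H : ℂ)⁻¹ • cosetElement H χ 1

lemma card_ne_zero_complex : (Nat.card H : ℂ) ≠ 0 := by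
  exact_mod_cast (Nat.card_pos (α := H)).ne'

lemma characterProjection_coeff (k : G) :
    (characterProjection H χ).coeff k = (Nat.card H : ℂ)⁻¹ * cosetFunction H χ 1 k := by
  rw [characterProjection, MonoidAlgebra.coeff_smul, Finsupp.smul_apply, cosetElement_coeff,
    smul_eq_mul]

lemma isStarProjection_characterProjection : IsStarProjection (characterProjection H χ) := by
  refine ⟨?_, ?_⟩
  · have h := card_ne_zero_complex H
    rw [IsIdempotentElem, characterProjection, smul_mul_smul_comm, cosetElement_mul_self, smul_smul]
    congr 1
    field_simp
  · rw [IsSelfAdjoint, characterProjection, star_smul_eq, star_cosetElement]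
    simp

lemma algTrace_characterProjection :
    algTrace G (characterProjection H χ) = (Fintype.card G : ℂ) * (Nat.card H : ℂ)⁻¹ := by
  rw [algTrace_apply, characterProjection_coeff]
  have h := cosetFunction_one_coe H χ 1
  rw [OneMemClass.coe_one, map_one] at h
  rw [h]
  simp

lemma isStarProjection_fun_iff {G : Type*} {f : G → ℂ} :
    IsStarProjection f ↔ ∀ k, f k = 0 ∨ f k = 1 := by
  refine ⟨fun h k => ?_, fun h => ⟨?_, ?_⟩⟩
  · have h1 : f k * f k = f k := congrFun h.isIdempotentElem.eq k
    rcases eq_or_ne (f k) 0 with h0 | h0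
    · exact Or.inl h0
    · exact Or.inr (mul_left_cancel₀ h0 (by rw [h1, mul_one]))
  · funext k
    rcases h k with h | h <;> simp [h]
  · funext k
    rcases h k with h | h <;> simp [h]

lemma isStarProjection_cosetFunction (g : G) : IsStarProjection (cosetFunction H 1 g) := by
  rw [isStarProjection_fun_iff]
  intro k
  by_cases hk : k * g⁻¹ ∈ H
  · exact Or.inr (cosetFunction_trivial_of_mem H hk)
  · exact Or.inl (cosetFunction_of_notMem H 1 hk)

open scoped Classical in
lemma sum_cosetFunction_mul (g : G) (f : G → ℂ) :
    ∑ k, cosetFunction H χ g k * f k = ∑ h : H, (χ h : ℂ) * f (h * g) := by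
  simp only [cosetFunction, Finset.sum_apply, Finset.sum_mul, Pi.single_apply, ite_mul, zero_mul]
  rw [Finset.sum_comm]
  simp

open scoped Classical in
lemma funTrace_cosetFunction (g : G) : funTrace G (cosetFunction H 1 g) = Nat.card H := by
  have h := sum_cosetFunction_mul H 1 g 1
  simpa [funTrace_apply, Nat.card_eq_fintype_card] using h

end Cosets

section Shifts

lemma isRangeProjection_smul_iff {A : Type*} [Ring A] [StarRing A] [Algebra ℂ A] {p q : A}
    (hp : IsStarProjection p) {c : ℂ} (hc : c ≠ 0) : IsRangeProjection q (c • p) ↔ q = p := by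
  have key : ∀ r : A, r * c • p = c • p ↔ r * p = p := fun r => by
    rw [mul_smul_comm]
    exact (smul_right_injective A hc).eq_iff
  refine ⟨fun h => ?_, ?_⟩
  · have h1 : q * p = p := (key q).1 h.mul_eq
    have h2 : p * q = q := h.le p hp ((key p).2 hp.isIdempotentElem.eq)
    have h3 := congrArg star h1
    rwa [star_mul, hp.isSelfAdjoint.star_eq, h.proj.isSelfAdjoint.star_eq, h2] at h3
  · rintro rfl
    exact ⟨hp, (key _).2 hp.isIdempotentElem.eq, fun r _ hr => (key r).1 hr⟩

variable {G : Type*} [Group G] [Fintype G]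

lemma card_ne_zero_complex_univ (G : Type*) [Group G] [Fintype G] :
    (Fintype.card G : ℂ) ≠ 0 := by
  exact_mod_cast Fintype.card_ne_zero

lemma exists_eq_characterProjection_of_support {P : MonoidAlgebra ℂ G} (hP : IsStarProjection P)
    (H : Subgroup G) (h1 : P.coeff 1 = (Nat.card H : ℂ)⁻¹) (hH : ∀ k, k ∉ H → P.coeff k = 0) :
    ∃ χ : H →* ℂˣ, P = characterProjection H χ := by
  classical
  have hH0 := card_ne_zero_complex H
  have hP1 : P.coeff 1 ≠ 0 := by
    rw [h1]
    exact inv_ne_zero hH0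
  have hn : ‖P.coeff 1‖ = (Nat.card H : ℝ)⁻¹ := by
    rw [h1, norm_inv, Complex.norm_natCast]
  obtain ⟨K, χ, hK, hχ, -⟩ := exists_character_of_projection hP hP1
  have hKH : K = H := by
    refine le_antisymm (fun k hk => ?_) fun k hk => ?_
    · by_contra hkH
      have h2 := (hK k).1 hk
      rw [hH k hkH, norm_zero] at h2
      exact hP1 (norm_eq_zero.1 h2.symm)
    · have hs : ∑ g ∈ Finset.univ.filter (· ∈ H), ‖P.coeff g‖ ^ 2 =
          ∑ g ∈ Finset.univ.filter (· ∈ H), ‖P.coeff 1‖ ^ 2 := by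
        rw [Finset.sum_filter_of_ne, sum_normSq_projection hP, Finset.sum_const, nsmul_eq_mul,
          ← Fintype.card_subtype, ← norm_projection_coeff_one hP, hn]
        · have h3 : (Nat.card H : ℝ) ≠ 0 := by exact_mod_cast hH0
          have h4 : (Fintype.card {x // x ∈ H} : ℝ) = Nat.card H := by
            rw [Nat.card_eq_fintype_card]
          rw [h4]
          field_simp
        · intro g _ hg
          by_contra hgH
          simp [hH g hgH] at hg
      rw [Finset.sum_eq_sum_iff_of_le fun g _ =>
        pow_le_pow_left₀ (norm_nonneg _) (norm_projection_coeff_le hP g) 2] at hs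
      rw [hK]
      exact (pow_left_inj₀ (norm_nonneg _) (norm_nonneg _) two_ne_zero).1
        (hs k (by simpa using hk))
  subst hKH
  refine ⟨χ, ext_coeff fun k => ?_⟩
  rw [characterProjection_coeff]
  by_cases hk : k ∈ K
  · rw [hχ ⟨k, hk⟩, h1, ← cosetFunction_one_coe, mul_comm]
  · rw [hH k hk, cosetFunction_of_notMem, mul_zero]
    simpa using hk

lemma isRightShift_characterProjection_iff (H : Subgroup G) (P : MonoidAlgebra ℂ G) :
    IsRightShift (fourierFun G) (algTrace G) (delta G) P (characterProjection H 1) ↔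
      ∃ χ : H →* ℂˣ, P = characterProjection H χ := by
  have hH0 := card_ne_zero_complex H
  have hG0 := card_ne_zero_complex_univ G
  have hd := delta_ne_zero G
  have hd2 := delta_sq G
  have hcop : coproduct (fourierFun G) (characterProjection H 1) P =
      (algTrace G (characterProjection H 1) / (delta G : ℂ)) • P ↔
      ∀ k, k ∉ H → P.coeff k = 0 := by
    rw [← MonoidAlgebra.coeff_inj, Finsupp.ext_iff]
    refine forall_congr' fun k => ?_
    rw [coproduct_alg_coeff, MonoidAlgebra.coeff_smul, Finsupp.smul_apply, smul_eq_mul,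
      algTrace_characterProjection, characterProjection_coeff, ← hd2]
    by_cases hk : k ∈ H
    · rw [cosetFunction_trivial_of_mem H (by simpa using hk)]
      simp only [hk, not_true_eq_false, false_imp_iff, iff_true]
      field_simp
    · rw [cosetFunction_of_notMem H 1 (by simpa using hk)]
      simp only [hk, not_false_eq_true, true_imp_iff]
      simp [hd, hH0, eq_comm (a := (0 : ℂ))]
  refine ⟨fun ⟨hP, htr, hc⟩ => ?_, ?_⟩
  · refine exists_eq_characterProjection_of_support hP H ?_ (hcop.1 hc)
    rw [algTrace_apply, algTrace_characterProjection] at htr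
    exact mul_left_cancel₀ hG0 htr
  · rintro ⟨χ, rfl⟩
    refine ⟨isStarProjection_characterProjection H χ, ?_, hcop.2 fun k hk => ?_⟩
    · rw [algTrace_characterProjection, algTrace_characterProjection]
    · rw [characterProjection_coeff, cosetFunction_of_notMem, mul_zero]
      simpa using hk

lemma eq_of_zero_one_of_le_of_sum_eq {ι : Type*} {s : Finset ι} {u v : ι → ℂ}
    (hv : ∀ i, v i = 0 ∨ v i = 1) (hu : ∀ i, u i = 0 ∨ u i = 1) (huv : ∀ i ∈ s, u i = 1 → v i = 1)
    (hsum : ∑ i ∈ s, u i = ∑ i ∈ s, v i) : ∀ i ∈ s, u i = v i := by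
  have h1 : ∀ i ∈ s, (u i).re ≤ (v i).re := fun i hi => by
    rcases hu i with h | h
    · rcases hv i with h' | h' <;> simp [h, h']
    · rw [h, huv i hi h]
  have h2 := congrArg Complex.re hsum
  rw [Complex.re_sum, Complex.re_sum, Finset.sum_eq_sum_iff_of_le h1] at h2
  intro i hi
  have h3 := h2 i hi
  rcases hu i with h | h <;> rcases hv i with h' | h' <;> simp_all

open scoped Classical in
lemma isRightShift_cosetFunction_iff (H : Subgroup G) (Q : G → ℂ) :
    IsRightShift (fourierAlg G) (funTrace G) (delta G) Q (cosetFunction H 1 1) ↔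
      ∃ g, Q = cosetFunction H 1 g := by
  have hH0 := card_ne_zero_complex H
  have hd := delta_ne_zero G
  have hcop : coproduct (fourierAlg G) (cosetFunction H 1 1) Q =
      (funTrace G (cosetFunction H 1 1) / (delta G : ℂ)) • Q ↔
      ∀ k, ∑ h : H, Q ((h : G)⁻¹ * k) = Nat.card H * Q k := by
    rw [funext_iff]
    refine forall_congr' fun k => ?_
    rw [coproduct_fun_apply, sum_cosetFunction_mul H 1 1 fun g => Q (g⁻¹ * k),
      funTrace_cosetFunction, Pi.smul_apply, smul_eq_mul]
    simp only [MonoidHom.one_apply, Units.val_one, one_mul, mul_one]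
    rw [div_mul_eq_mul_div, div_eq_inv_mul]
    exact mul_right_inj' (inv_ne_zero hd)
  refine ⟨fun ⟨hQ, htr, hc⟩ => ?_, ?_⟩
  · rw [hcop] at hc
    rw [isStarProjection_fun_iff] at hQ
    have h1 : ∃ g, Q g = 1 := by
      by_contra! hne
      have h0 : Q = 0 := funext fun g => (hQ g).resolve_right (hne g)
      rw [h0, map_zero, funTrace_cosetFunction] at htr
      exact hH0 htr.symm
    obtain ⟨g, hg⟩ := h1
    have h2 : ∀ h : H, Q ((h : G)⁻¹ * g) = 1 := fun h =>
      eq_of_zero_one_of_le_of_sum_eq (s := Finset.univ) (u := fun h : H => Q ((h : G)⁻¹ * g))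
        (v := fun _ => 1) (by simp) (fun h => hQ _) (by simp)
        (by simp [hc g, hg, Nat.card_eq_fintype_card]) h (Finset.mem_univ h)
    refine ⟨g, funext fun k => (eq_of_zero_one_of_le_of_sum_eq hQ
      (isStarProjection_fun_iff.1 (isStarProjection_cosetFunction H g)) (s := Finset.univ)
      (fun k _ hk => ?_) ?_ k (Finset.mem_univ k)).symm⟩
    · have h3 : k * g⁻¹ ∈ H := (cosetFunction_ne_zero H 1).1 (by rw [hk]; exact one_ne_zero)
      simpa using h2 ⟨k * g⁻¹, h3⟩⁻¹
    · rw [← funTrace_apply, ← funTrace_apply, htr, funTrace_cosetFunction, funTrace_cosetFunction]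
  · rintro ⟨g, rfl⟩
    refine ⟨isStarProjection_cosetFunction H g, ?_, hcop.2 fun k => ?_⟩
    · rw [funTrace_cosetFunction, funTrace_cosetFunction]
    · have h1 : ∀ h : H, cosetFunction H 1 g ((h : G)⁻¹ * k) = cosetFunction H 1 g k := fun h => by
        have h2 : (h : G)⁻¹ * k * g⁻¹ ∈ H ↔ k * g⁻¹ ∈ H := by
          rw [mul_assoc]
          exact H.mul_mem_cancel_left (H.inv_mem h.2)
        by_cases hk : k * g⁻¹ ∈ H
        · rw [cosetFunction_trivial_of_mem H hk, cosetFunction_trivial_of_mem H (h2.2 hk)]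
        · rw [cosetFunction_of_notMem H 1 hk, cosetFunction_of_notMem H 1 (h2.not.2 hk)]
      simp [h1, Nat.card_eq_fintype_card]

/-- A projection of the group algebra whose coefficients take at most one nonzero value is the
average of a subgroup. -/
lemma exists_eq_characterProjection_one {p : MonoidAlgebra ℂ G} (hp : IsStarProjection p)
    (h0 : p ≠ 0) {c : ℂ} (hc : ∀ k, p.coeff k = 0 ∨ p.coeff k = c) :
    ∃ H : Subgroup G, p = characterProjection H 1 := by
  classical
  have h1 : p.coeff 1 ≠ 0 := fun h => h0 (projection_eq_zero hp h)
  have hc1 : p.coeff 1 = c := (hc 1).resolve_left h1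
  obtain ⟨H, χ, hH, -, -⟩ := exists_character_of_projection hp h1
  have hmem : ∀ k, k ∈ H → p.coeff k = p.coeff 1 := fun k hk => by
    rcases hc k with h | h
    · have h2 := (hH k).1 hk
      rw [h, norm_zero] at h2
      exact absurd (norm_eq_zero.1 h2.symm) h1
    · rw [h, hc1]
  have hnot : ∀ k, k ∉ H → p.coeff k = 0 := fun k hk => by
    rcases hc k with h | h
    · exact h
    · exact absurd ((hH k).2 (by rw [h, hc1])) hk
  refine ⟨H, ext_coeff fun k => ?_⟩
  have hval : p.coeff 1 = (Nat.card H : ℂ)⁻¹ := by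
    have h2 := sum_star_mul_translate hp 1
    rw [← Finset.sum_subset (Finset.subset_univ (Finset.univ.filter (· ∈ H)))
      (fun g _ hg => by rw [hnot g (by simpa using hg), star_zero, zero_mul]),
      Finset.sum_congr rfl fun g hg => by rw [mul_one, hmem g (Finset.mem_filter.1 hg).2],
      Finset.sum_const, nsmul_eq_mul, ← Fintype.card_subtype, ← mul_assoc,
      mul_eq_right₀ h1, ← projection_coeff_inv hp, inv_one] at h2
    rw [Nat.card_eq_fintype_card]
    exact eq_inv_of_mul_eq_one_right h2
  rw [characterProjection_coeff, ← hval]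
  by_cases hk : k ∈ H
  · rw [hmem k hk, cosetFunction_trivial_of_mem H (by simpa using hk), mul_one]
  · rw [hnot k hk, cosetFunction_of_notMem, mul_zero]
    simpa using hk

lemma fourierAlg_characterProjection (H : Subgroup G) :
    fourierAlg G (characterProjection H 1) =
      ((delta G : ℂ) * (Nat.card H : ℂ)⁻¹) • cosetFunction H 1 1 := by
  funext k
  rw [fourierAlg_apply, characterProjection_coeff, Pi.smul_apply, smul_eq_mul, mul_assoc]

lemma fourierFun_cosetFunction (H : Subgroup G) :
    fourierFun G (cosetFunction H 1 1) =
      ((delta G : ℂ)⁻¹ * (Nat.card H : ℂ)) • characterProjection H 1 := by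
  have hH0 := card_ne_zero_complex H
  refine ext_coeff fun k => ?_
  rw [fourierFun_coeff, MonoidAlgebra.coeff_smul, Finsupp.smul_apply, smul_eq_mul,
    characterProjection_coeff, mul_assoc, mul_inv_cancel_left₀ hH0]
  by_cases hk : k ∈ H
  · rw [cosetFunction_trivial_of_mem, cosetFunction_trivial_of_mem] <;> simpa using hk
  · rw [cosetFunction_of_notMem, cosetFunction_of_notMem] <;> simpa using hk

lemma exists_subgroup_of_isBiprojection_alg {B : MonoidAlgebra ℂ G}
    (hB : IsBiprojection (fourierAlg G) B) (h0 : B ≠ 0) :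
    ∃ H : Subgroup G, B = characterProjection H 1 := by
  obtain ⟨hB1, c, p, hp, hF⟩ := hB
  have hd := delta_ne_zero G
  rw [isStarProjection_fun_iff] at hp
  refine exists_eq_characterProjection_one hB1 h0 (c := (delta G : ℂ)⁻¹ * c) fun k => ?_
  have h := congrFun hF k
  rw [fourierAlg_apply, Pi.smul_apply, smul_eq_mul] at h
  rcases hp k with hk | hk
  · rw [hk, mul_zero] at h
    exact Or.inl ((mul_eq_zero.1 h).resolve_left hd)
  · rw [hk, mul_one] at h
    exact Or.inr (by rw [← h, inv_mul_cancel_left₀ hd])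

lemma exists_subgroup_of_isBiprojection_fun {B : G → ℂ}
    (hB : IsBiprojection (fourierFun G) B) (h0 : B ≠ 0) :
    ∃ H : Subgroup G, B = cosetFunction H 1 1 := by
  obtain ⟨hB1, c, p, hp, hF⟩ := hB
  have hd := delta_ne_zero G
  rw [isStarProjection_fun_iff] at hB1
  have hF0 : fourierFun G B ≠ 0 := by simpa using h0
  have hc : c ≠ 0 := by
    rintro rfl
    exact hF0 (by rw [hF, zero_smul])
  have hp0 : p ≠ 0 := by
    rintro rfl
    exact hF0 (by rw [hF, smul_zero])
  have hk : ∀ k, (delta G : ℂ)⁻¹ * B k⁻¹ = c * p.coeff k := fun k => by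
    rw [← fourierFun_coeff, hF, MonoidAlgebra.coeff_smul, Finsupp.smul_apply, smul_eq_mul]
  obtain ⟨H, rfl⟩ := exists_eq_characterProjection_one hp hp0 (c := c⁻¹ * (delta G : ℂ)⁻¹)
    fun k => by
      have h := hk k
      rcases hB1 k⁻¹ with h1 | h1
      · rw [h1, mul_zero] at h
        exact Or.inl ((mul_eq_zero.1 h.symm).resolve_left hc)
      · rw [h1, mul_one] at h
        exact Or.inr (by rw [h, inv_mul_cancel_left₀ hc])
  refine ⟨H, funext fun k => ?_⟩
  have h := hk k⁻¹
  have hH0 := card_ne_zero_complex H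
  rw [inv_inv, characterProjection_coeff] at h
  by_cases hkH : k ∈ H
  · rw [cosetFunction_trivial_of_mem H (by simpa using hkH)] at h ⊢
    refine (hB1 k).resolve_left fun h1 => ?_
    rw [h1, mul_zero] at h
    simp [hc, hH0] at h
  · rw [cosetFunction_of_notMem H 1 (by simpa using hkH)] at h ⊢
    simpa [hd] using h

lemma isBiprojection_characterProjection (H : Subgroup G) :
    IsBiprojection (fourierAlg G) (characterProjection H 1) :=
  ⟨isStarProjection_characterProjection H 1, _, _, isStarProjection_cosetFunction H 1,
    fourierAlg_characterProjection H⟩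

lemma isBiprojection_cosetFunction (H : Subgroup G) :
    IsBiprojection (fourierFun G) (cosetFunction H 1 1) :=
  ⟨isStarProjection_cosetFunction H 1, _, _, isStarProjection_characterProjection H 1,
    fourierFun_cosetFunction H⟩

end Shifts

section Bishifts

variable {G : Type*} [Group G] [Fintype G]

lemma isAlgBishift_iff {x : MonoidAlgebra ℂ G} :
    IsAlgBishift x ↔ x ≠ 0 ∧ ∃ (H : Subgroup G) (χ : H →* ℂˣ) (g : G) (y : MonoidAlgebra ℂ G),
      ∀ k, x.coeff k = cosetFunction H 1 g k⁻¹ * (y * characterProjection H χ).coeff k := by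
  have hd := delta_ne_zero G
  have hcoeff : ∀ (Q : G → ℂ) (z : MonoidAlgebra ℂ G),
      x = coproduct (fourierFun G) (fourierFun G Q) z ↔
        ∀ k, x.coeff k = Q k⁻¹ * z.coeff k := fun Q z => by
    rw [← MonoidAlgebra.coeff_inj, Finsupp.ext_iff]
    refine forall_congr' fun k => ?_
    rw [coproduct_alg_coeff, fourierFun_coeff, mul_assoc, mul_inv_cancel_left₀ hd]
  have hr : ∀ (H : Subgroup G) (B' : G → ℂ),
      IsRangeProjection B' (fourierAlg G (characterProjection H 1)) ↔ B' = cosetFunction H 1 1 :=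
    fun H B' => by
      rw [fourierAlg_characterProjection]
      exact isRangeProjection_smul_iff (isStarProjection_cosetFunction H 1)
        (mul_ne_zero hd (inv_ne_zero (card_ne_zero_complex H)))
  refine and_congr_right fun hx => ⟨?_, ?_⟩
  · rintro ⟨B, hB, B', hB', P, hP, Q, hQ, y, hy⟩
    have hB0 : B ≠ 0 := by
      rintro rfl
      have h := hP.2.1
      rw [map_zero, algTrace_apply] at h
      have hP0 := projection_eq_zero hP.1
        ((mul_eq_zero.1 h).resolve_left (card_ne_zero_complex_univ G))
      refine hx (ext_coeff fun k => ?_)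
      rw [(hcoeff _ _).1 hy k, hP0]
      simp
    obtain ⟨H, rfl⟩ := exists_subgroup_of_isBiprojection_alg hB hB0
    obtain rfl := (hr H B').1 hB'
    obtain ⟨χ, rfl⟩ := (isRightShift_characterProjection_iff H P).1 hP
    obtain ⟨g, rfl⟩ := (isRightShift_cosetFunction_iff H Q).1 hQ
    exact ⟨H, χ, g, y, (hcoeff _ _).1 hy⟩
  · rintro ⟨H, χ, g, y, hy⟩
    exact ⟨_, isBiprojection_characterProjection H, _, (hr H _).2 rfl, _,
      (isRightShift_characterProjection_iff H _).2 ⟨χ, rfl⟩, _,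
      (isRightShift_cosetFunction_iff H _).2 ⟨g, rfl⟩, y, (hcoeff _ _).2 hy⟩

open scoped Classical in
lemma isFunBishift_iff {x : G → ℂ} :
    IsFunBishift x ↔ x ≠ 0 ∧ ∃ (H : Subgroup G) (χ : H →* ℂˣ) (g : G) (y : G → ℂ),
      ∀ k, x k = (Nat.card H : ℂ)⁻¹ *
        ∑ h : H, (χ h : ℂ) * (y ((h : G)⁻¹ * k) * cosetFunction H 1 g ((h : G)⁻¹ * k)) := by
  have hd := delta_ne_zero G
  have hcoeff : ∀ (Q : MonoidAlgebra ℂ G) (z : G → ℂ),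
      x = coproduct (fourierAlg G) (fourierAlg G Q) z ↔
        ∀ k, x k = ∑ a, Q.coeff a * z (a⁻¹ * k) := fun Q z => by
    rw [funext_iff]
    refine forall_congr' fun k => ?_
    simp only [coproduct_fun_apply, fourierAlg_apply, mul_assoc]
    rw [← Finset.mul_sum, inv_mul_cancel_left₀ hd]
  have hcoeff' : ∀ (H : Subgroup G) (χ : H →* ℂˣ) (z : G → ℂ),
      x = coproduct (fourierAlg G) (fourierAlg G (characterProjection H χ)) z ↔
        ∀ k, x k = (Nat.card H : ℂ)⁻¹ * ∑ h : H, (χ h : ℂ) * z ((h : G)⁻¹ * k) := fun H χ z => by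
    rw [hcoeff]
    refine forall_congr' fun k => ?_
    simp only [characterProjection_coeff, mul_assoc]
    rw [← Finset.mul_sum, sum_cosetFunction_mul H χ 1 fun a => z (a⁻¹ * k)]
    simp only [mul_one]
  have hr : ∀ (H : Subgroup G) (B' : MonoidAlgebra ℂ G),
      IsRangeProjection B' (fourierFun G (cosetFunction H 1 1)) ↔ B' = characterProjection H 1 :=
    fun H B' => by
      rw [fourierFun_cosetFunction]
      exact isRangeProjection_smul_iff (isStarProjection_characterProjection H 1)
        (mul_ne_zero (inv_ne_zero hd) (card_ne_zero_complex H))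
  refine and_congr_right fun hx => ⟨?_, ?_⟩
  · rintro ⟨B, hB, B', hB', P, hP, Q, hQ, y, hy⟩
    have hB0 : B ≠ 0 := by
      rintro rfl
      have h := hP.2.1
      rw [map_zero, funTrace_apply] at h
      have hP0 : ∀ k, P k = 0 := fun k =>
        (eq_of_zero_one_of_le_of_sum_eq (isStarProjection_fun_iff.1 hP.1) (u := 0)
          (s := Finset.univ) (by simp) (by simp) (by simp [h]) k (Finset.mem_univ k)).symm
      refine hx (funext fun k => ?_)
      rw [(hcoeff _ _).1 hy k]
      simp [hP0]
    obtain ⟨H, rfl⟩ := exists_subgroup_of_isBiprojection_fun hB hB0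
    obtain rfl := (hr H B').1 hB'
    obtain ⟨χ, rfl⟩ := (isRightShift_characterProjection_iff H Q).1 hQ
    obtain ⟨g, rfl⟩ := (isRightShift_cosetFunction_iff H P).1 hP
    exact ⟨H, χ, g, y, (hcoeff' H χ (y * cosetFunction H 1 g)).1 hy⟩
  · rintro ⟨H, χ, g, y, hy⟩
    exact ⟨_, isBiprojection_cosetFunction H, _, (hr H _).2 rfl, _,
      (isRightShift_cosetFunction_iff H _).2 ⟨g, rfl⟩, _,
      (isRightShift_characterProjection_iff H _).2 ⟨χ, rfl⟩, y,
      (hcoeff' H χ (y * cosetFunction H 1 g)).2 hy⟩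

end Bishifts

section CosetElements

variable {G : Type*} [Group G] [Fintype G] (H : Subgroup G) (χ : H →* ℂˣ)

lemma cosetFunction_mul_right (h : H) (k : G) :
    cosetFunction H χ 1 (k * h) = cosetFunction H χ 1 k * χ h := by
  by_cases hk : k ∈ H
  · have h1 := cosetFunction_one_coe H χ (⟨k, hk⟩ * h)
    have h2 := cosetFunction_one_coe H χ ⟨k, hk⟩
    rw [map_mul, Units.val_mul, ← h2] at h1
    exact h1
  · rw [cosetFunction_of_notMem, cosetFunction_of_notMem, zero_mul]
    · simpa using hk
    · simpa [H.mul_mem_cancel_right h.2] using hk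

lemma mul_characterProjection_coeff (y : MonoidAlgebra ℂ G) (h : H) (k : G) :
    (y * characterProjection H χ).coeff (k * h) =
      (y * characterProjection H χ).coeff k * χ h := by
  rw [coeff_mul_eq_sum, coeff_mul_eq_sum, Finset.sum_mul]
  refine Finset.sum_congr rfl fun a _ => ?_
  rw [characterProjection_coeff, characterProjection_coeff, ← mul_assoc a⁻¹,
    cosetFunction_mul_right]
  ring

lemma smul_cosetElement_coeff (c : ℂ) (g k : G) :
    (c • cosetElement H χ g).coeff k = c * cosetFunction H χ g k := by
  rw [MonoidAlgebra.coeff_smul, Finsupp.smul_apply, cosetElement_coeff, smul_eq_mul]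

lemma smul_cosetElement_ne_zero {c : ℂ} (hc : c ≠ 0) (g : G) : c • cosetElement H χ g ≠ 0 := by
  intro h
  have h1 := congrArg (fun x : MonoidAlgebra ℂ G => x.coeff g) h
  simp only [smul_cosetElement_coeff] at h1
  exact mul_ne_zero hc ((cosetFunction_ne_zero H χ).2 (by simp)) h1

lemma smul_cosetElement_eq {c : ℂ} (g : G) : c • cosetElement H χ g =
    (c * Nat.card H) • (characterProjection H χ * MonoidAlgebra.single g 1) := by
  rw [cosetElement_eq_mul_single, characterProjection, smul_mul_assoc, smul_smul, mul_assoc,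
    mul_inv_cancel₀ (card_ne_zero_complex H), mul_one]

theorem isAlgBishift_iff_exists_cosetElement {x : MonoidAlgebra ℂ G} :
    IsAlgBishift x ↔ ∃ (H : Subgroup G) (χ : H →* ℂˣ) (g : G) (c : ℂ), c ≠ 0 ∧
      x = c • cosetElement H χ g := by
  rw [isAlgBishift_iff]
  constructor
  · rintro ⟨hx, H, χ, g, y, hy⟩
    obtain ⟨K, ψ, hψ⟩ := exists_conj_cosetFunction H χ g
    have hxc : x = (y * characterProjection H χ).coeff g⁻¹ • cosetElement K ψ g⁻¹ := by
      refine ext_coeff fun k => ?_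
      have h1 := hψ (g * k)
      rw [inv_mul_cancel_left] at h1
      have h3 : k⁻¹ * g⁻¹ ∈ H ↔ g * k ∈ H := by
        rw [← mul_inv_rev, inv_mem_iff]
      rw [smul_cosetElement_coeff, hy, cosetFunction_eq_translate K, inv_inv, h1]
      by_cases hk : g * k ∈ H
      · have h2 := mul_characterProjection_coeff H χ y ⟨g * k, hk⟩ g⁻¹
        rw [inv_mul_cancel_left, ← cosetFunction_one_coe] at h2
        rw [cosetFunction_trivial_of_mem H (h3.2 hk), one_mul, h2]
      · rw [cosetFunction_of_notMem H 1 (h3.not.2 hk), cosetFunction_of_notMem H χ, zero_mul,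
          mul_zero]
        simpa using hk
    refine ⟨K, ψ, g⁻¹, _, fun hc => hx ?_, hxc⟩
    rw [hxc, hc, zero_smul]
  · rintro ⟨H, χ, g, c, hc, rfl⟩
    refine ⟨smul_cosetElement_ne_zero H χ hc g, ?_⟩
    obtain ⟨K, ψ, hψ⟩ := exists_conj_cosetFunction H χ g
    refine ⟨K, ψ, g⁻¹, MonoidAlgebra.single g (c * Nat.card K), fun k => ?_⟩
    have h1 := hψ (k * g⁻¹)
    rw [mul_assoc, inv_mul_cancel_right] at h1
    rw [smul_cosetElement_coeff, cosetFunction_eq_translate, ← h1,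
      MonoidAlgebra.coeff_single_mul_apply, characterProjection_coeff, mul_assoc,
      mul_inv_cancel_left₀ (card_ne_zero_complex K)]
    have h3 : k⁻¹ * g⁻¹⁻¹ ∈ K ↔ g⁻¹ * k ∈ K := by
      rw [← mul_inv_rev, inv_mem_iff]
    by_cases hk : g⁻¹ * k ∈ K
    · rw [cosetFunction_trivial_of_mem K (h3.2 hk), one_mul]
    · rw [cosetFunction_of_notMem K ψ (by simpa using hk), mul_zero, mul_zero]

theorem isFunBishift_iff_exists_cosetFunction {f : G → ℂ} :
    IsFunBishift f ↔ ∃ (H : Subgroup G) (χ : H →* ℂˣ) (g : G) (c : ℂ), c ≠ 0 ∧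
      f = c • cosetFunction H χ g := by
  classical
  rw [isFunBishift_iff]
  constructor
  · rintro ⟨hf, H, χ, g, y, hy⟩
    have hfc : f = f g • cosetFunction H χ g := by
      funext k
      rw [Pi.smul_apply, smul_eq_mul]
      by_cases hk : k * g⁻¹ ∈ H
      · rw [cosetFunction_of_mem H χ hk, hy, hy g, mul_assoc]
        congr 1
        rw [Finset.sum_mul, ← Equiv.sum_comp (Equiv.mulLeft (⟨k * g⁻¹, hk⟩ : H))]
        refine Finset.sum_congr rfl fun h _ => ?_
        have h1 : ((⟨k * g⁻¹, hk⟩ * h : H) : G)⁻¹ * k = (h : G)⁻¹ * g := by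
          simp [mul_assoc]
        rw [Equiv.coe_mulLeft, h1, map_mul, Units.val_mul]
        ring
      · rw [cosetFunction_of_notMem H χ hk, mul_zero, hy, Finset.sum_eq_zero, mul_zero]
        intro h _
        rw [cosetFunction_of_notMem H 1, mul_zero, mul_zero]
        rw [mul_assoc]
        exact fun h1 => hk ((H.mul_mem_cancel_left (H.inv_mem h.2)).1 h1)
    refine ⟨H, χ, g, f g, fun hc => hf ?_, hfc⟩
    rw [hfc, hc, zero_smul]
  · rintro ⟨H, χ, g, c, hc, rfl⟩
    refine ⟨?_, H, χ, g, Pi.single g (c * Nat.card H), fun k => ?_⟩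
    · intro h
      have h1 := congrFun h g
      rw [Pi.smul_apply, smul_eq_mul] at h1
      exact mul_ne_zero hc ((cosetFunction_ne_zero H χ).2 (by simp)) h1
    · rw [Pi.smul_apply, smul_eq_mul]
      by_cases hk : k * g⁻¹ ∈ H
      · rw [Finset.sum_eq_single ⟨k * g⁻¹, hk⟩]
        · have h1 : ((⟨k * g⁻¹, hk⟩ : H) : G)⁻¹ * k = g := by simp
          rw [h1, Pi.single_eq_same, cosetFunction_trivial_of_mem H (by simp),
            cosetFunction_of_mem H χ hk]
          have h2 := card_ne_zero_complex H
          field_simp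
        · intro b _ hb
          rw [Pi.single_eq_of_ne, zero_mul, mul_zero]
          intro h1
          exact hb (Subtype.ext (eq_mul_inv_of_mul_eq (by rw [← h1, mul_inv_cancel_left])))
        · simp
      · rw [cosetFunction_of_notMem H χ hk, mul_zero, Finset.sum_eq_zero, mul_zero]
        intro h _
        rw [cosetFunction_of_notMem H 1, mul_zero, mul_zero]
        rw [mul_assoc]
        exact fun h1 => hk ((H.mul_mem_cancel_left (H.inv_mem h.2)).1 h1)

end CosetElements

section DonohoStark

variable {G : Type*} [Group G] [Fintype G]

open scoped Classical in
/-- The equality case of the Donoho-Stark inequality. -/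
theorem exists_cosetElement_of_projection_mul {p x : MonoidAlgebra ℂ G} (hp : IsStarProjection p)
    (hpx : p * x = x) (hx : x ≠ 0)
    (hS : p.coeff 1 * ((Finset.univ.filter fun k => x.coeff k ≠ 0).card : ℂ) = 1) :
    ∃ (H : Subgroup G) (χ : H →* ℂˣ) (g : G) (c : ℂ), c ≠ 0 ∧ x = c • cosetElement H χ g := by
  set S := Finset.univ.filter fun k => x.coeff k ≠ 0 with hSdef
  have hmemS : ∀ k, k ∈ S ↔ x.coeff k ≠ 0 := fun k => by simp [hSdef]
  have hp1 : p.coeff 1 ≠ 0 := left_ne_zero_of_mul_eq_one hS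
  have hS0 : (S.card : ℂ) ≠ 0 := right_ne_zero_of_mul_eq_one hS
  have hnS : ‖p.coeff 1‖ * (S.card : ℝ) = 1 := by
    have h := congrArg norm hS
    rwa [norm_mul, Complex.norm_natCast, norm_one] at h
  obtain ⟨H, χ, hH, hχ, hcard⟩ := exists_character_of_projection hp hp1
  have hexp : ∀ k, x.coeff k = ∑ a ∈ S, p.coeff (k * a⁻¹) * x.coeff a := fun k => by
    conv_lhs => rw [← hpx, MonoidAlgebra.coeff_mul_apply_right, Finsupp.sum_fintype _ _ (by simp)]
    refine (Finset.sum_subset (Finset.subset_univ _) fun a _ ha => ?_).symm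
    rw [hmemS, not_not] at ha
    rw [ha, mul_zero]
  obtain ⟨m, -, hm⟩ := Finset.exists_max_image Finset.univ (fun k => ‖x.coeff k‖)
    Finset.univ_nonempty
  have hterm : ∀ k, ∀ a ∈ S, ‖p.coeff (k * a⁻¹) * x.coeff a‖ ≤ ‖p.coeff 1‖ * ‖x.coeff m‖ :=
    fun k a _ => by
      rw [norm_mul]
      exact mul_le_mul (norm_projection_coeff_le hp _) (hm a (Finset.mem_univ a)) (norm_nonneg _)
        (norm_nonneg _)
  have hmax : ‖x.coeff m‖ ≠ 0 := fun h0 => hx <| ext_coeff fun k => by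
    have h1 := hm k (Finset.mem_univ k)
    rw [h0] at h1
    simpa using h1
  have hconst : ∑ _a ∈ S, ‖p.coeff 1‖ * ‖x.coeff m‖ = ‖x.coeff m‖ := by
    rw [Finset.sum_const, nsmul_eq_mul, ← mul_assoc, mul_comm (S.card : ℝ), hnS, one_mul]
  have heq : ∀ k, ‖x.coeff k‖ = ‖x.coeff m‖ → ∀ a ∈ S,
      ‖p.coeff (k * a⁻¹) * x.coeff a‖ = ‖p.coeff 1‖ * ‖x.coeff m‖ := fun k hk => by
    rw [← Finset.sum_eq_sum_iff_of_le (hterm k)]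
    refine le_antisymm (Finset.sum_le_sum (hterm k)) ?_
    rw [hconst, ← hk]
    conv_lhs => rw [hexp k]
    exact norm_sum_le _ _
  have hxS : ∀ a ∈ S, ‖x.coeff a‖ = ‖x.coeff m‖ := fun a ha => by
    have h1 := heq m rfl a ha
    rw [norm_mul] at h1
    refine le_antisymm (hm a (Finset.mem_univ a)) ?_
    refine le_of_mul_le_mul_left ?_ (norm_pos_iff.2 hp1)
    rw [← h1]
    exact mul_le_mul_of_nonneg_right (norm_projection_coeff_le hp _) (norm_nonneg _)
  have hmS : m ∈ S := (hmemS m).2 (norm_ne_zero_iff.1 hmax)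
  have hSH : ∀ k ∈ S, ∀ a ∈ S, k * a⁻¹ ∈ H := fun k hk a ha => by
    have h1 := heq k (hxS k hk) a ha
    rw [norm_mul, hxS a ha] at h1
    exact (hH _).2 (mul_right_cancel₀ hmax h1)
  have himage : S = Finset.univ.filter fun k => k * m⁻¹ ∈ H := by
    refine Finset.eq_of_subset_of_card_le (fun k hk => by simpa using hSH k hk m hmS) ?_
    have h1 : (Finset.univ.filter fun k => k * m⁻¹ ∈ H).card = Nat.card H := by
      rw [Nat.card_eq_fintype_card, Fintype.card_subtype]
      refine Finset.card_bij (fun k _ => k * m⁻¹) (by simp) (by simp) fun b hb =>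
        ⟨b * m, by simpa using hb, by simp⟩
    rw [h1]
    have h2 : (Nat.card H : ℝ) * ‖p.coeff 1‖ ≤ S.card * ‖p.coeff 1‖ := by
      rw [mul_comm (S.card : ℝ), hnS]
      exact hcard
    exact_mod_cast le_of_mul_le_mul_right h2 (norm_pos_iff.2 hp1)
  refine ⟨H, χ, m, x.coeff m, norm_ne_zero_iff.1 hmax, ext_coeff fun k => ?_⟩
  rw [smul_cosetElement_coeff]
  by_cases hk : k * m⁻¹ ∈ H
  · rw [cosetFunction_of_mem H χ hk]
    have h1 : ∀ a ∈ S, p.coeff (k * a⁻¹) * x.coeff a =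
        χ ⟨k * m⁻¹, hk⟩ * (p.coeff (m * a⁻¹) * x.coeff a) := fun a ha => by
      have h2 := hSH m hmS a ha
      have h3 := hχ (⟨k * m⁻¹, hk⟩ * ⟨m * a⁻¹, h2⟩)
      have h4 := hχ ⟨m * a⁻¹, h2⟩
      rw [map_mul, Units.val_mul, mul_assoc, ← h4] at h3
      have h5 : (((⟨k * m⁻¹, hk⟩ * ⟨m * a⁻¹, h2⟩ : H)) : G) = k * a⁻¹ := by simp
      rw [h5] at h3
      rw [h3, mul_assoc]
    conv_lhs => rw [hexp k, Finset.sum_congr rfl h1, ← Finset.mul_sum, ← hexp m]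
    rw [mul_comm]
  · rw [cosetFunction_of_notMem H χ hk, mul_zero]
    have h1 : k ∉ S := by
      rw [himage]
      simpa using hk
    rwa [hmemS, not_not] at h1

open scoped Classical in
lemma funTrace_rangeProjection {G : Type*} [Fintype G] {f q : G → ℂ} (hq : IsRangeProjection q f) :
    funTrace G q = ((Finset.univ.filter fun k => f k ≠ 0).card : ℂ) := by
  have hind : IsStarProjection (fun k => if f k ≠ 0 then 1 else 0 : G → ℂ) := by
    rw [isStarProjection_fun_iff]
    intro k
    by_cases h : f k = 0 <;> simp [h]
  have h1 := hq.le _ hind (by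
    funext k
    by_cases h : f k = 0 <;> simp [h])
  have h2 : q = fun k => if f k ≠ 0 then 1 else 0 := by
    funext k
    have h3 := congrFun hq.mul_eq k
    have h4 := congrFun h1 k
    by_cases h : f k = 0
    · simpa [h, eq_comm] using h4
    · simpa [h] using h3
  rw [h2, funTrace_apply, Finset.sum_boole]

lemma isRangeProjection_cosetElement (H : Subgroup G) (χ : H →* ℂˣ) (g : G) {c : ℂ} (hc : c ≠ 0) :
    IsRangeProjection (characterProjection H χ) (c • cosetElement H χ g) := by
  have hcH : c * Nat.card H ≠ 0 := mul_ne_zero hc (card_ne_zero_complex H)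
  refine ⟨isStarProjection_characterProjection H χ, ?_, fun q _ hq => ?_⟩
  · rw [smul_cosetElement_eq, mul_smul_comm, ← mul_assoc,
      (isStarProjection_characterProjection H χ).isIdempotentElem.eq]
  · rw [smul_cosetElement_eq, mul_smul_comm, (smul_right_injective _ hcH).eq_iff, ← mul_assoc] at hq
    have h1 := congrArg (· * MonoidAlgebra.single g⁻¹ (1 : ℂ)) hq
    simpa [mul_assoc, MonoidAlgebra.single_mul_single, ← MonoidAlgebra.one_def] using h1

lemma isRangeProjection_fourierAlg_cosetElement (H : Subgroup G) (χ : H →* ℂˣ) (g : G) {c : ℂ}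
    (hc : c ≠ 0) :
    IsRangeProjection (cosetFunction H 1 g) (fourierAlg G (c • cosetElement H χ g)) := by
  have hd := delta_ne_zero G
  have hval : ∀ k, fourierAlg G (c • cosetElement H χ g) k =
      (delta G : ℂ) * (c * cosetFunction H χ g k) := fun k => by
    rw [fourierAlg_apply, smul_cosetElement_coeff]
  refine ⟨isStarProjection_cosetFunction H g, funext fun k => ?_, fun q _ hq => funext fun k => ?_⟩
  · rw [Pi.mul_apply, hval]
    by_cases hk : k * g⁻¹ ∈ H
    · rw [cosetFunction_trivial_of_mem H hk, one_mul]
    · rw [cosetFunction_of_notMem H χ hk, mul_zero, mul_zero, mul_zero]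
  · rw [Pi.mul_apply]
    by_cases hk : k * g⁻¹ ∈ H
    · have h1 := congrFun hq k
      rw [Pi.mul_apply, hval] at h1
      rw [(mul_eq_right₀ (mul_ne_zero hd
        (mul_ne_zero hc ((cosetFunction_ne_zero H χ).2 hk)))).1 h1, one_mul]
    · rw [cosetFunction_of_notMem H 1 hk, mul_zero]

theorem isDonohoStarkMinimizer_iff_exists_cosetElement {x : MonoidAlgebra ℂ G} :
    IsDonohoStarkMinimizer x ↔ ∃ (H : Subgroup G) (χ : H →* ℂˣ) (g : G) (c : ℂ), c ≠ 0 ∧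
      x = c • cosetElement H χ g := by
  classical
  constructor
  · rintro ⟨hx, p, q, hp, hq, htr⟩
    refine exists_cosetElement_of_projection_mul hp.proj hp.mul_eq hx ?_
    rw [funTrace_rangeProjection hq, algTrace_apply, delta_sq, mul_assoc,
      mul_eq_left₀ (card_ne_zero_complex_univ G)] at htr
    have hd := delta_ne_zero G
    simpa [fourierAlg_apply, hd] using htr
  · rintro ⟨H, χ, g, c, hc, rfl⟩
    refine ⟨smul_cosetElement_ne_zero H χ hc g, _, _, isRangeProjection_cosetElement H χ g hc,
      isRangeProjection_fourierAlg_cosetElement H χ g hc, ?_⟩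
    rw [algTrace_characterProjection, funTrace_cosetFunction, delta_sq,
      inv_mul_cancel_right₀ (card_ne_zero_complex H)]

end DonohoStark

section BoundaryUniqueness

open Filter Topology Complex

/-- A case of Hopf's boundary lemma: an entire function bounded by `1` on the strip
`0 ≤ re z ≤ 1`, with value `1` and derivative `0` at `0`, is constant. -/
theorem eq_one_of_norm_le_one_of_deriv_eq_zero {F : ℂ → ℂ} (hF : Differentiable ℂ F)
    (h0 : F 0 = 1) (h1 : deriv F 0 = 0) (hb : ∀ z : ℂ, 0 ≤ z.re → z.re ≤ 1 → ‖F z‖ ≤ 1) (z : ℂ) :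
    F z = 1 := by
  have hA : AnalyticOnNhd ℂ F Set.univ := fun z _ => hF.analyticAt z
  by_cases hc : ∀ᶠ z in 𝓝 (0 : ℂ), F z - 1 = 0
  · have h2 : F =ᶠ[𝓝 0] fun _ => 1 := hc.mono fun z hz => sub_eq_zero.1 hz
    exact congrFun (hA.eq_of_eventuallyEq analyticOnNhd_const h2) z
  exfalso
  have hG : AnalyticAt ℂ (fun z => F z - 1) 0 := (hF.analyticAt 0).sub analyticAt_const
  obtain ⟨k, g, hg, hg0, hFg⟩ := hG.exists_eventuallyEq_pow_smul_nonzero_iff.2 hc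
  simp only [sub_zero, smul_eq_mul] at hFg
  have hk : 2 ≤ k := by
    by_contra! hk
    interval_cases k
    · have h2 := hFg.self_of_nhds
      simp only [h0, sub_self, pow_zero, one_mul] at h2
      exact hg0 h2.symm
    · have h2 : deriv (fun z => F z - 1) 0 = deriv (fun z : ℂ => z ^ 1 * g z) 0 :=
        EventuallyEq.deriv_eq hFg
      rw [deriv_sub_const, h1] at h2
      simp only [pow_one] at h2
      rw [deriv_fun_mul differentiableAt_fun_id hg.differentiableAt] at h2
      simp at h2
      exact hg0 h2.symm
  have hk0 : (0 : ℝ) < k := by exact_mod_cast (by omega : 0 < k)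
  have hk2 : (2 : ℝ) ≤ k := by exact_mod_cast hk
  set α := arg (g 0) with hα
  have hα1 : |α| ≤ Real.pi := abs_arg_le_pi _
  set θ : ℝ := -(3 * α) / (4 * k) with hθ
  have hkθ : k * θ + α = α / 4 := by
    rw [hθ]
    field_simp
    ring
  have hθ1 : |θ| < Real.pi / 2 := by
    rw [hθ, abs_div, abs_neg, abs_mul, abs_mul, abs_of_pos hk0, div_lt_iff₀ (by positivity)]
    norm_num
    nlinarith [Real.pi_pos]
  set ζ : ℂ := exp (θ * I) with hζ
  have hζre : 0 < ζ.re := by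
    rw [hζ, exp_ofReal_mul_I_re]
    exact Real.cos_pos_of_mem_Ioo (abs_lt.1 hθ1)
  have hζg : 0 < (ζ ^ k * g 0).re := by
    have h2 : ζ ^ k * g 0 = ‖g 0‖ * exp ((α / 4 : ℝ) * I) := by
      conv_lhs => rw [← norm_mul_exp_arg_mul_I (g 0)]
      rw [hζ, ← exp_nat_mul, ← hkθ, ← hα, mul_left_comm, ← exp_add]
      congr 2
      push_cast
      ring
    rw [h2, re_ofReal_mul, exp_ofReal_mul_I_re]
    refine mul_pos (norm_pos_iff.2 hg0) (Real.cos_pos_of_mem_Ioo (abs_lt.1 ?_))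
    rw [abs_div]
    norm_num
    linarith [Real.pi_pos]
  have hlim : Tendsto (fun r : ℝ => (r : ℂ) * ζ) (𝓝 0) (𝓝 0) := by
    have h2 : Continuous fun r : ℝ => (r : ℂ) * ζ := by fun_prop
    simpa using h2.tendsto 0
  have e1 : ∀ᶠ r : ℝ in 𝓝 0, 0 < (ζ ^ k * g (r * ζ)).re := by
    have h2 : Tendsto (fun r : ℝ => (ζ ^ k * g (r * ζ)).re) (𝓝 0) (𝓝 (ζ ^ k * g 0).re) :=
      (continuous_re.tendsto _).comp ((hg.continuousAt.tendsto.comp hlim).const_mul _)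
    exact h2.eventually (lt_mem_nhds hζg)
  have e2 : ∀ᶠ r : ℝ in 𝓝 0, ((r : ℂ) * ζ).re < 1 := by
    have h2 : Tendsto (fun r : ℝ => ((r : ℂ) * ζ).re) (𝓝 0) (𝓝 (0 : ℂ).re) :=
      (continuous_re.tendsto _).comp hlim
    exact h2.eventually (gt_mem_nhds (by simp))
  have e3 := hlim.eventually hFg
  have e4 : ∀ᶠ r : ℝ in 𝓝[>] 0, 0 < r := self_mem_nhdsWithin
  obtain ⟨r, ⟨⟨hr1, hr2⟩, hr3⟩, hr4⟩ :=
    ((((e1.and e2).and e3).filter_mono nhdsWithin_le_nhds).and e4).exists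
  have h3 : F (r * ζ) = 1 + (r ^ k : ℝ) * (ζ ^ k * g (r * ζ)) := by
    rw [← sub_eq_iff_eq_add', hr3]
    push_cast
    ring
  have h4 : ‖F (r * ζ)‖ ≤ 1 :=
    hb _ (by rw [re_ofReal_mul]; positivity) hr2.le
  have h5 : 1 < (F (r * ζ)).re := by
    rw [h3, add_re, one_re, re_ofReal_mul]
    have := mul_pos (pow_pos hr4 k) hr1
    linarith
  linarith [re_le_norm (F (r * ζ))]

/-- A finite exponential sum with real frequencies which is bounded by `1` on the two boundary
lines of the strip `0 ≤ re z ≤ 1`, and has value `1` and derivative `0` at `0`, is constant. -/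
theorem expSum_eq_one {ι : Type*} [Fintype ι] (a : ι → ℝ) (c : ι → ℂ)
    (hc : ∑ j, c j = 1) (hac : ∑ j, c j * a j = 0)
    (hb0 : ∀ z : ℂ, z.re = 0 → ‖∑ j, c j * exp (a j * z)‖ ≤ 1)
    (hb1 : ∀ z : ℂ, z.re = 1 → ‖∑ j, c j * exp (a j * z)‖ ≤ 1) (z : ℂ) :
    ∑ j, c j * exp (a j * z) = 1 := by
  have hd : ∀ z, HasDerivAt (fun z => ∑ j, c j * exp (a j * z))
      (∑ j, c j * (exp (a j * z) * a j)) z := fun z => by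
    refine HasDerivAt.fun_sum fun j _ => ?_
    have h1 : HasDerivAt (fun z : ℂ => (a j : ℂ) * z) (a j) z := by
      simpa using (hasDerivAt_id z).const_mul (a j : ℂ)
    exact h1.cexp.const_mul (c j)
  have hdiff : Differentiable ℂ fun z => ∑ j, c j * exp (a j * z) := fun z =>
    (hd z).differentiableAt
  refine eq_one_of_norm_le_one_of_deriv_eq_zero hdiff (by simpa using hc) ?_ ?_ z
  · rw [(hd 0).deriv]
    simpa using hac
  · intro z hz0 hz1
    refine PhragmenLindelof.vertical_strip (f := fun z => ∑ j, c j * exp (a j * z))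
      hdiff.diffContOnCl ⟨0, by simpa using Real.pi_pos, 0, ?_⟩ hb0 hb1 hz0 hz1
    refine Asymptotics.IsBigO.of_bound (∑ j, ‖c j‖ * Real.exp |a j|) ?_
    refine eventually_inf_principal.2 (Eventually.of_forall fun w hw => ?_)
    simp only [zero_mul, Real.exp_zero, norm_one, mul_one]
    refine (norm_sum_le _ _).trans (Finset.sum_le_sum fun j _ => ?_)
    rw [norm_mul, norm_exp, re_ofReal_mul]
    refine mul_le_mul_of_nonneg_left (Real.exp_le_exp.2 ?_) (norm_nonneg _)
    calc a j * w.re ≤ |a j| * |w.re| := by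
          rw [← abs_mul]
          exact le_abs_self _
      _ ≤ |a j| * 1 := by
          refine mul_le_mul_of_nonneg_left ?_ (abs_nonneg _)
          rw [abs_of_pos hw.1]
          exact hw.2.le
      _ = |a j| := mul_one _

end BoundaryUniqueness

section EntropyEquality

open Complex

lemma eq_ofReal_of_norm_le_of_sum_eq {ι : Type*} [Fintype ι] {u : ι → ℂ} {r : ι → ℝ}
    (hle : ∀ j, ‖u j‖ ≤ r j) (hsum : ∑ j, u j = ∑ j, (r j : ℂ)) (j : ι) : u j = r j := by
  have h1 := congrArg re hsum
  simp only [re_sum, ofReal_re] at h1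
  rw [Finset.sum_eq_sum_iff_of_le fun j _ => (re_le_norm _).trans (hle j)] at h1
  have h2 := h1 j (Finset.mem_univ j)
  have h3 : ‖u j‖ = (u j).re := le_antisymm ((hle j).trans h2.ge) (re_le_norm _)
  refine Complex.ext (by simpa using h2) ?_
  have h4 := Complex.re_eq_norm.1 h3.symm
  simpa using (Complex.nonneg_iff.1 h4).2.symm

/-- The equality case of an abstract Hirschman-Beckner inequality. In the application, `t` are the
eigenvalues of `x⋆ x`, `v` are the eigenvectors and `b i g = ⟪x v i, g v i⟫`. -/
theorem mul_eq_of_entropy_eq {ι G : Type*} [Fintype ι] [Fintype G] {n : ℝ} (hn : 0 < n)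
    {t : ι → ℝ} (ht : ∀ i, 0 ≤ t i) {x : G → ℂ} {b : ι → G → ℂ}
    (hb : ∀ i g, ‖b i g‖ ≤ Real.sqrt (t i))
    (hbx : ∀ i, ∑ g, x g * b i g = t i)
    (hbi : ∀ g, ∑ i, b i g = n * star (x g))
    (hcs : ∀ (e : ι → ℂ) (w : G → ℂ), (∀ i, ‖e i‖ ≤ 1) →
      ‖∑ i, e i * ∑ g, w g * b i g‖ ≤ Real.sqrt (∑ i, t i) * Real.sqrt (n * ∑ g, ‖w g‖ ^ 2))
    (hN : 0 < ∑ g, ‖x g‖ ^ 2)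
    (heq : ∑ i, t i * Real.log (t i) + 2 * n * ∑ g, ‖x g‖ ^ 2 * Real.log ‖x g‖ =
      2 * n * (∑ g, ‖x g‖ ^ 2) * Real.log (∑ g, ‖x g‖ ^ 2)) (i : ι) (g : G) :
    x g * b i g = (‖x g‖ * Real.sqrt (t i) : ℝ) := by
  set N := ∑ g, ‖x g‖ ^ 2 with hNdef
  have hnN : 0 < n * N := mul_pos hn hN
  have hnNc : ((n * N : ℝ) : ℂ) ≠ 0 := by exact_mod_cast hnN.ne'
  have hxx : ∀ g, x g * star (x g) = ((‖x g‖ ^ 2 : ℝ) : ℂ) := fun g => by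
    rw [star_def, mul_conj, normSq_eq_norm_sq]
  have hxb : ∀ g, ∑ i, x g * b i g = ((n * ‖x g‖ ^ 2 : ℝ) : ℂ) := fun g => by
    rw [← Finset.mul_sum, hbi, mul_left_comm, hxx]
    push_cast
    ring
  have hT : ∑ i, t i = n * N := by
    apply ofReal_injective
    rw [ofReal_sum, hNdef, Finset.mul_sum, ofReal_sum, ← Finset.sum_congr rfl fun i _ => hbx i,
      Finset.sum_comm]
    exact Finset.sum_congr rfl fun g _ => hxb g
  let a : ι × G → ℝ := fun j => Real.log (t j.1) / 2 + Real.log ‖x j.2‖ - Real.log N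
  let c : ι × G → ℂ := fun j => ((n * N : ℝ) : ℂ)⁻¹ * (x j.2 * b j.1 j.2)
  have hb0 : ∀ i, t i = 0 → ∀ g, b i g = 0 := fun i hi g => by
    have h := hb i g
    rw [hi, Real.sqrt_zero] at h
    simpa using h
  let r : ι × G → ℝ := fun j => (n * N)⁻¹ * (t j.1 * (‖x j.2‖ ^ 2 * N⁻¹))
  have hexp : ∀ j : ι × G, t j.1 ≠ 0 → x j.2 ≠ 0 →
      Real.exp (a j) = Real.sqrt (t j.1) * ‖x j.2‖ * N⁻¹ := fun j h1 h2 => by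
    have h3 : 0 < Real.sqrt (t j.1) := Real.sqrt_pos.2 (lt_of_le_of_ne (ht _) h1.symm)
    rw [Real.exp_sub, Real.exp_add, Real.exp_log hN, Real.exp_log (norm_pos_iff.2 h2),
      ← Real.log_sqrt (ht _), Real.exp_log h3, div_eq_mul_inv]
  have hterm : ∀ j, ‖c j‖ * Real.exp (a j) ≤ r j := fun j => by
    have hnorm : ‖c j‖ = (n * N)⁻¹ * (‖x j.2‖ * ‖b j.1 j.2‖) := by
      rw [norm_mul, norm_mul, norm_inv, norm_real, Real.norm_eq_abs, abs_of_pos hnN]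
    by_cases h1 : t j.1 = 0
    · simp [hnorm, hb0 _ h1, r, h1]
    by_cases h2 : x j.2 = 0
    · simp [hnorm, h2, r]
    rw [hexp j h1 h2, hnorm]
    calc (n * N)⁻¹ * (‖x j.2‖ * ‖b j.1 j.2‖) * (Real.sqrt (t j.1) * ‖x j.2‖ * N⁻¹)
        ≤ (n * N)⁻¹ * (‖x j.2‖ * Real.sqrt (t j.1)) * (Real.sqrt (t j.1) * ‖x j.2‖ * N⁻¹) := by
          gcongr
          exact hb _ _
      _ = (n * N)⁻¹ * (Real.sqrt (t j.1) ^ 2 * (‖x j.2‖ ^ 2 * N⁻¹)) := by ring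
      _ = r j := by rw [Real.sq_sqrt (ht _)]
  have hr : ∑ j, r j = 1 := by
    rw [Fintype.sum_prod_type]
    simp only [r]
    simp only [← Finset.mul_sum, ← Finset.sum_mul]
    rw [hT, ← hNdef, mul_inv_cancel₀ hN.ne', mul_one, inv_mul_cancel₀ hnN.ne']
  have hone := expSum_eq_one a c ?_ ?_ ?_ ?_ 1
  · have h1 := eq_ofReal_of_norm_le_of_sum_eq (u := fun j => c j * exp (a j * 1)) (r := r)
      (fun j => by
        rw [norm_mul, norm_exp, mul_one, ofReal_re]
        exact hterm j) (by rw [hone, ← ofReal_sum, hr, ofReal_one]) (i, g)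
    by_cases h2 : t i = 0
    · simp [hb0 i h2, h2]
    by_cases h3 : x g = 0
    · simp [h3]
    have h4 : (Real.sqrt (t i) : ℂ) ≠ 0 := by
      exact_mod_cast (Real.sqrt_pos.2 (lt_of_le_of_ne (ht i) (Ne.symm h2))).ne'
    have h5 : (‖x g‖ : ℂ) ≠ 0 := by exact_mod_cast norm_ne_zero_iff.2 h3
    have h6 : (N : ℂ) ≠ 0 := by exact_mod_cast hN.ne'
    have h7 : (t i : ℂ) = (Real.sqrt (t i) : ℂ) ^ 2 := by
      rw [← ofReal_pow, Real.sq_sqrt (ht i)]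
    rw [mul_one, ← ofReal_exp, hexp (i, g) h2 h3] at h1
    have hrj : (r (i, g) : ℂ) = ((n * N : ℝ) : ℂ)⁻¹ *
        ((Real.sqrt (t i) : ℂ) ^ 2 * ((‖x g‖ : ℂ) ^ 2 * (N : ℂ)⁻¹)) := by
      simp only [r]
      rw [← h7]
      push_cast
      ring
    simp only [c] at h1
    rw [hrj, mul_assoc] at h1
    have h8 := mul_left_cancel₀ (inv_ne_zero hnNc) h1
    push_cast at h8 ⊢
    have h9 : (Real.sqrt (t i) : ℂ) * ‖x g‖ * (N : ℂ)⁻¹ ≠ 0 :=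
      mul_ne_zero (mul_ne_zero h4 h5) (inv_ne_zero h6)
    refine mul_right_cancel₀ h9 (h8.trans ?_)
    ring
  · rw [Fintype.sum_prod_type]
    simp only [c]
    simp only [← Finset.mul_sum]
    rw [Finset.sum_congr rfl fun i _ => hbx i, ← ofReal_sum, hT, inv_mul_cancel₀ hnNc]
  · have h1 : ∀ j, c j * a j = ((n * N : ℝ) : ℂ)⁻¹ *
        ((x j.2 * b j.1 j.2) * ((Real.log (t j.1) / 2 : ℝ) : ℂ) +
          (x j.2 * b j.1 j.2) * ((Real.log ‖x j.2‖ : ℝ) : ℂ) -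
          (x j.2 * b j.1 j.2) * ((Real.log N : ℝ) : ℂ)) := fun j => by
      simp only [c, a]
      push_cast
      ring
    rw [Finset.sum_congr rfl fun j _ => h1 j, ← Finset.mul_sum, Finset.sum_sub_distrib,
      Finset.sum_add_distrib]
    have s1 : ∑ j : ι × G, x j.2 * b j.1 j.2 * ((Real.log (t j.1) / 2 : ℝ) : ℂ) =
        ((∑ i, t i * Real.log (t i)) / 2 : ℝ) := by
      rw [Fintype.sum_prod_type, Finset.sum_div, ofReal_sum]
      refine Finset.sum_congr rfl fun i _ => ?_
      dsimp only
      rw [← Finset.sum_mul, hbx i]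
      push_cast
      ring
    have s2 : ∑ j : ι × G, x j.2 * b j.1 j.2 * ((Real.log ‖x j.2‖ : ℝ) : ℂ) =
        (n * ∑ g, ‖x g‖ ^ 2 * Real.log ‖x g‖ : ℝ) := by
      rw [Fintype.sum_prod_type_right, Finset.mul_sum, ofReal_sum]
      refine Finset.sum_congr rfl fun g _ => ?_
      dsimp only
      rw [← Finset.sum_mul, hxb g]
      push_cast
      ring
    have s3 : ∑ j : ι × G, x j.2 * b j.1 j.2 * ((Real.log N : ℝ) : ℂ) =
        (n * N * Real.log N : ℝ) := by
      rw [← Finset.sum_mul, Fintype.sum_prod_type, Finset.sum_congr rfl fun i _ => hbx i,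
        ← ofReal_sum, hT, ← ofReal_mul]
    rw [s1, s2, s3, ← ofReal_add, ← ofReal_sub]
    have h2 : (∑ i, t i * Real.log (t i)) / 2 + n * ∑ g, ‖x g‖ ^ 2 * Real.log ‖x g‖ -
        n * N * Real.log N = 0 := by linarith
    rw [h2, ofReal_zero, mul_zero]
  · intro z hz
    have hunit : ∀ s : ℝ, ‖exp ((s : ℂ) * z)‖ = 1 := fun s => by
      rw [norm_exp, re_ofReal_mul, hz, mul_zero, Real.exp_zero]
    have h1 : ∑ j, c j * exp (a j * z) = ((n * N : ℝ) : ℂ)⁻¹ * exp ((-Real.log N : ℝ) * z) *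
        ∑ i, exp ((Real.log (t i) / 2 : ℝ) * z) *
          ∑ g, (x g * exp ((Real.log ‖x g‖ : ℝ) * z)) * b i g := by
      rw [Fintype.sum_prod_type]
      simp only [Finset.mul_sum]
      refine Finset.sum_congr rfl fun i _ => Finset.sum_congr rfl fun g _ => ?_
      have h2 : (a (i, g) : ℂ) * z = ((-Real.log N : ℝ) : ℂ) * z +
          ((Real.log (t i) / 2 : ℝ) : ℂ) * z + ((Real.log ‖x g‖ : ℝ) : ℂ) * z := by
        simp only [a]
        push_cast
        ring
      rw [h2, exp_add, exp_add]
      simp only [c]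
      ring
    rw [h1, norm_mul, norm_mul, hunit, norm_inv, norm_real, Real.norm_eq_abs, abs_of_pos hnN,
      mul_one, inv_mul_le_iff₀ hnN, mul_one]
    refine (hcs _ _ fun i => (hunit _).le).trans ?_
    simp only [norm_mul, hunit, mul_one]
    rw [hT, Real.mul_self_sqrt hnN.le]
  · intro z hz
    refine (norm_sum_le _ _).trans ?_
    rw [← hr]
    refine Finset.sum_le_sum fun j _ => ?_
    rw [norm_mul, norm_exp, re_ofReal_mul, hz, mul_one]
    exact hterm j

/-- In the equality case, `|x|` is constant on the support of `x`, and the singular values `√t`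
are all equal to the sum of the `‖x g‖`. -/
theorem flat_of_entropy_eq {ι G : Type*} [Fintype ι] [Fintype G] {n : ℝ} (hn : 0 < n)
    {t : ι → ℝ} (ht : ∀ i, 0 ≤ t i) {x : G → ℂ} {b : ι → G → ℂ}
    (hbx : ∀ i, ∑ g, x g * b i g = t i)
    (hbi : ∀ g, ∑ i, b i g = n * star (x g))
    (hxb : ∀ i g, x g * b i g = (‖x g‖ * Real.sqrt (t i) : ℝ)) :
    (∃ r, ∀ g, x g ≠ 0 → ‖x g‖ = r) ∧ ∀ i, t i ≠ 0 → t i = (∑ g, ‖x g‖) ^ 2 := by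
  refine ⟨⟨(∑ i, Real.sqrt (t i)) / n, fun g hg => ?_⟩, fun i hi => ?_⟩
  · have h1 : ∑ i, x g * b i g = ∑ i, ((‖x g‖ * Real.sqrt (t i) : ℝ) : ℂ) :=
      Finset.sum_congr rfl fun i _ => hxb i g
    rw [← Finset.mul_sum, hbi, mul_left_comm, star_def, mul_conj, normSq_eq_norm_sq,
      ← ofReal_sum, ← ofReal_mul, ← Finset.mul_sum] at h1
    have h2 := ofReal_injective h1
    have h3 : ‖x g‖ ≠ 0 := norm_ne_zero_iff.2 hg
    rw [eq_div_iff hn.ne']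
    refine mul_left_cancel₀ h3 ?_
    rw [← h2]
    ring
  · have h1 := hbx i
    rw [Finset.sum_congr rfl fun g _ => hxb i g, ← ofReal_sum, ← Finset.sum_mul] at h1
    have h2 := ofReal_injective h1
    have h3 := Real.sq_sqrt (ht i)
    have h4 : Real.sqrt (t i) ≠ 0 := fun h => hi (by rw [← h3, h]; ring)
    have h5 : Real.sqrt (t i) = ∑ g, ‖x g‖ := by
      refine mul_right_cancel₀ h4 ?_
      rw [h2, ← sq, h3]
    rw [← h5, h3]

end EntropyEquality

section LeftRegular

variable {G : Type*} [Group G] [Fintype G]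

lemma leftRegular_mul (x y : MonoidAlgebra ℂ G) :
    leftRegular (x * y) = leftRegular x * leftRegular y := by
  ext a b
  rw [Matrix.mul_apply]
  simp only [leftRegular, Matrix.of_apply]
  rw [coeff_mul_eq_sum, ← Equiv.sum_comp ((Equiv.inv G).trans (Equiv.mulLeft a))]
  exact Finset.sum_congr rfl fun c _ => by simp [mul_assoc]

lemma leftRegular_star (x : MonoidAlgebra ℂ G) :
    leftRegular (star x) = (leftRegular x).conjTranspose := by
  ext a b
  simp [leftRegular, Matrix.conjTranspose_apply, coeff_star]

lemma leftRegular_add {G : Type*} [Group G] (x y : MonoidAlgebra ℂ G) :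
    leftRegular (x + y) = leftRegular x + leftRegular y := by
  ext a b
  simp [leftRegular]

lemma leftRegular_smul {G : Type*} [Group G] (c : ℂ) (x : MonoidAlgebra ℂ G) :
    leftRegular (c • x) = c • leftRegular x := by
  ext a b
  simp [leftRegular]

lemma leftRegular_injective (G : Type*) [Group G] :
    Function.Injective (leftRegular (G := G)) := fun x y h =>
  ext_coeff fun k => by simpa [leftRegular] using congrFun (congrFun h k) 1

lemma trace_leftRegular (x : MonoidAlgebra ℂ G) :
    (leftRegular x).trace = (Fintype.card G : ℂ) * x.coeff 1 := by
  simp [Matrix.trace, leftRegular]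

lemma coeff_one_star_mul (x y : MonoidAlgebra ℂ G) :
    (star x * y).coeff 1 = ∑ k, star (x.coeff k) * y.coeff k := by
  rw [coeff_mul_eq_sum, ← Equiv.sum_comp (Equiv.inv G)]
  simp [coeff_star]

lemma coeff_one_star_mul_self (x : MonoidAlgebra ℂ G) :
    (star x * x).coeff 1 = ((∑ k, ‖x.coeff k‖ ^ 2 : ℝ) : ℂ) := by
  rw [coeff_one_star_mul, Complex.ofReal_sum]
  refine Finset.sum_congr rfl fun k _ => ?_
  rw [mul_comm, Complex.star_def, Complex.mul_conj, Complex.normSq_eq_norm_sq]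

lemma norm2_sq (x : MonoidAlgebra ℂ G) :
    norm2 (algTrace G) x ^ 2 = Fintype.card G * ∑ k, ‖x.coeff k‖ ^ 2 := by
  rw [norm2, algTrace_apply, coeff_one_star_mul_self, ← Complex.ofReal_natCast,
    ← Complex.ofReal_mul, Complex.ofReal_re, Real.sq_sqrt (by positivity)]

lemma sum_normSq_pos {x : MonoidAlgebra ℂ G} (hx : x ≠ 0) : 0 < ∑ k, ‖x.coeff k‖ ^ 2 := by
  refine lt_of_le_of_ne (by positivity) fun h => hx (ext_coeff fun k => ?_)
  rw [eq_comm, Finset.sum_eq_zero_iff_of_nonneg fun _ _ => by positivity] at h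
  simpa using h k (Finset.mem_univ k)

end LeftRegular

section HirschmanBeckner

variable {G : Type*} [Group G] [Fintype G]

lemma funEntropy_fourierAlg (x : MonoidAlgebra ℂ G) :
    funEntropy (fourierAlg G x) =
      -(Fintype.card G * (∑ k, ‖x.coeff k‖ ^ 2) * Real.log (Fintype.card G) +
        2 * Fintype.card G * ∑ k, ‖x.coeff k‖ ^ 2 * Real.log ‖x.coeff k‖) := by
  have hn : (0 : ℝ) < Fintype.card G := by exact_mod_cast Fintype.card_pos
  rw [funEntropy, Finset.mul_sum, Finset.mul_sum, Finset.sum_mul, ← Finset.sum_add_distrib,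
    ← Finset.sum_neg_distrib]
  refine Finset.sum_congr rfl fun k _ => ?_
  have h1 : ‖fourierAlg G x k‖ ^ 2 = Fintype.card G * ‖x.coeff k‖ ^ 2 := by
    rw [fourierAlg_apply, norm_mul, mul_pow, Complex.norm_real, Real.norm_eq_abs, sq_abs, delta,
      Real.sq_sqrt hn.le]
  rw [h1, Real.negMulLog]
  by_cases h : x.coeff k = 0
  · simp [h]
  · have h2 : ‖x.coeff k‖ ≠ 0 := norm_ne_zero_iff.2 h
    rw [Real.log_mul hn.ne' (pow_ne_zero 2 h2), Real.log_pow]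
    push_cast
    ring

lemma hirschmanBeckner_rhs {x : MonoidAlgebra ℂ G} (hx : x ≠ 0) :
    norm2 (algTrace G) x ^ 2 *
      (2 * Real.log (delta G) - 4 * Real.log (norm2 (algTrace G) x)) =
    -(Fintype.card G * (∑ k, ‖x.coeff k‖ ^ 2) * Real.log (Fintype.card G) +
        2 * Fintype.card G * (∑ k, ‖x.coeff k‖ ^ 2) * Real.log (∑ k, ‖x.coeff k‖ ^ 2)) := by
  have hn : (0 : ℝ) < Fintype.card G := by exact_mod_cast Fintype.card_pos
  have hN := sum_normSq_pos hx
  have h1 : 4 * Real.log (norm2 (algTrace G) x) = 2 * (Real.log (Fintype.card G) +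
      Real.log (∑ k, ‖x.coeff k‖ ^ 2)) := by
    rw [← Real.log_mul hn.ne' hN.ne', ← norm2_sq, Real.log_pow]
    push_cast
    ring
  have h2 : 2 * Real.log (delta G) = Real.log (Fintype.card G) := by
    rw [delta, Real.log_sqrt hn.le]
    ring
  rw [h1, h2, norm2_sq]
  ring

open scoped Classical in
lemma sum_eigenvalues (x : MonoidAlgebra ℂ G) :
    ∑ i, (Matrix.isHermitian_conjTranspose_mul_self (leftRegular x)).eigenvalues i =
      Fintype.card G * ∑ k, ‖x.coeff k‖ ^ 2 := by
  have h := (Matrix.isHermitian_conjTranspose_mul_self (leftRegular x)).trace_eq_sum_eigenvalues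
  have h1 : ((leftRegular x).conjTranspose * leftRegular x).trace =
      (Fintype.card G : ℂ) * ((∑ k, ‖x.coeff k‖ ^ 2 : ℝ) : ℂ) := by
    rw [← leftRegular_star, ← leftRegular_mul, trace_leftRegular, coeff_one_star_mul_self]
  apply Complex.ofReal_injective
  rw [h1] at h
  push_cast at h ⊢
  exact h.symm

lemma algEntropy_of_mul_star_mul {x : MonoidAlgebra ℂ G} {t : ℝ}
    (h : x * star x * x = (t : ℂ) • x) :
    algEntropy x = -(Fintype.card G * (∑ k, ‖x.coeff k‖ ^ 2) * Real.log t) := by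
  classical
  rw [algEntropy, ← sum_eigenvalues, Finset.sum_mul, ← Finset.sum_neg_distrib]
  refine Finset.sum_congr rfl fun i _ => ?_
  set hM := Matrix.isHermitian_conjTranspose_mul_self (leftRegular x)
  set e := hM.eigenvalues i
  set v : G → ℂ := (hM.eigenvectorBasis i).ofLp with hv
  have hMv : (((leftRegular x).conjTranspose * leftRegular x).mulVec v) = e • v :=
    hM.mulVec_eigenvectorBasis i
  have hMM : (leftRegular x).conjTranspose * leftRegular x *
      ((leftRegular x).conjTranspose * leftRegular x) =
      (t : ℂ) • ((leftRegular x).conjTranspose * leftRegular x) := by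
    rw [← leftRegular_star, ← leftRegular_mul, ← leftRegular_mul, ← leftRegular_smul,
      mul_assoc (star x), ← mul_assoc x, h, mul_smul_comm]
  have h1 := congrArg (fun A : Matrix G G ℂ => A.mulVec v) hMM
  simp only [← Matrix.mulVec_mulVec, Matrix.smul_mulVec] at h1
  simp only [Matrix.mulVec_mulVec, hMv, Matrix.mulVec_smul] at h1
  have hv0 : v ≠ 0 := by
    intro h0
    have h2 := hM.eigenvectorBasis.orthonormal.ne_zero i
    exact h2 (by ext k; exact congrFun h0 k)
  obtain ⟨k, hk⟩ := Function.ne_iff.1 hv0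
  have h2 := congrFun h1 k
  simp only [Pi.smul_apply, Complex.real_smul, smul_eq_mul] at h2
  have h3 : (e : ℂ) * e = t * e := by
    refine mul_right_cancel₀ hk ?_
    rw [mul_assoc, h2, mul_assoc]
  have h4 : e * e = t * e := by exact_mod_cast h3
  rw [Real.negMulLog]
  rcases eq_or_ne e 0 with h0 | h0
  · simp [h0]
  · rw [mul_right_cancel₀ h0 h4]
    ring

lemma sum_normSq_cosetElement (H : Subgroup G) (χ : H →* ℂˣ) (g : G) (c : ℂ) :
    ∑ k, ‖(c • cosetElement H χ g).coeff k‖ ^ 2 = Nat.card H * ‖c‖ ^ 2 := by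
  classical
  apply Complex.ofReal_injective
  have h1 : ∀ k, ((‖(c • cosetElement H χ g).coeff k‖ ^ 2 : ℝ) : ℂ) =
      cosetFunction H 1 g k * (‖c‖ : ℂ) ^ 2 := fun k => by
    rw [smul_cosetElement_coeff]
    by_cases hk : k * g⁻¹ ∈ H
    · rw [cosetFunction_trivial_of_mem H hk, cosetFunction_of_mem H χ hk, norm_mul, norm_character]
      simp
    · rw [cosetFunction_of_notMem H 1 hk, cosetFunction_of_notMem H χ hk]
      simp
  rw [Complex.ofReal_sum, Finset.sum_congr rfl fun k _ => h1 k, ← Finset.sum_mul,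
    ← funTrace_apply, funTrace_cosetFunction]
  push_cast
  rfl

lemma cosetElement_mul_star_mul (H : Subgroup G) (χ : H →* ℂˣ) (g : G) (c : ℂ) :
    c • cosetElement H χ g * star (c • cosetElement H χ g) * c • cosetElement H χ g =
      ((‖c‖ ^ 2 * (Nat.card H : ℝ) ^ 2 : ℝ) : ℂ) • c • cosetElement H χ g := by
  have hP := isStarProjection_characterProjection H χ
  have hstar : ∀ z : ℂ, star (z • (characterProjection H χ * MonoidAlgebra.single g 1)) =
      star z • (MonoidAlgebra.single g⁻¹ 1 * characterProjection H χ) := fun z => by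
    rw [star_smul_eq, star_mul, star_single_one, hP.isSelfAdjoint.star_eq]
  rw [smul_cosetElement_eq, hstar]
  have h3 : characterProjection H χ * MonoidAlgebra.single g 1 *
      (MonoidAlgebra.single g⁻¹ 1 * characterProjection H χ) = characterProjection H χ := by
    rw [mul_assoc, ← mul_assoc (MonoidAlgebra.single g (1 : ℂ)), MonoidAlgebra.single_mul_single,
      mul_inv_cancel, mul_one, ← MonoidAlgebra.one_def, one_mul, hP.isIdempotentElem.eq]
  rw [smul_mul_smul_comm, h3, smul_mul_assoc, mul_smul_comm, ← mul_assoc,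
    hP.isIdempotentElem.eq]
  congr 1
  rw [Complex.star_def, Complex.mul_conj, Complex.normSq_eq_norm_sq, norm_mul,
    Complex.norm_natCast, mul_pow]

theorem isHirschmanBecknerMinimizer_cosetElement (H : Subgroup G) (χ : H →* ℂˣ) (g : G) {c : ℂ}
    (hc : c ≠ 0) : IsHirschmanBecknerMinimizer (c • cosetElement H χ g) := by
  have hx := smul_cosetElement_ne_zero H χ hc g
  refine ⟨hx, ?_⟩
  rw [hirschmanBeckner_rhs hx, funEntropy_fourierAlg,
    algEntropy_of_mul_star_mul (cosetElement_mul_star_mul H χ g c)]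
  have hH : (Nat.card H : ℝ) ≠ 0 := by exact_mod_cast card_ne_zero_complex H
  have hc' : ‖c‖ ≠ 0 := norm_ne_zero_iff.2 hc
  have h1 : ∑ k, ‖(c • cosetElement H χ g).coeff k‖ ^ 2 *
      Real.log ‖(c • cosetElement H χ g).coeff k‖ =
      (∑ k, ‖(c • cosetElement H χ g).coeff k‖ ^ 2) * Real.log ‖c‖ := by
    rw [Finset.sum_mul]
    refine Finset.sum_congr rfl fun k _ => ?_
    rw [smul_cosetElement_coeff]
    by_cases hk : k * g⁻¹ ∈ H
    · rw [cosetFunction_of_mem H χ hk, norm_mul, norm_character, mul_one]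
    · rw [cosetFunction_of_notMem H χ hk]
      simp
  rw [h1, sum_normSq_cosetElement, Real.log_mul (pow_ne_zero 2 hc') (pow_ne_zero 2 hH),
    Real.log_mul hH (pow_ne_zero 2 hc'), Real.log_pow, Real.log_pow]
  push_cast
  ring

open scoped Classical in
/-- Left multiplication by `x` as an operator on `ℓ²(G)`. -/
noncomputable def leftOp (G : Type*) [Group G] [Fintype G] :
    MonoidAlgebra ℂ G →ₗ[ℂ] EuclideanSpace ℂ G →ₗ[ℂ] EuclideanSpace ℂ G where
  toFun x := Matrix.toEuclideanLin (leftRegular x)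
  map_add' x y := by rw [leftRegular_add, map_add]
  map_smul' c x := by rw [leftRegular_smul, map_smul, RingHom.id_apply]

open scoped Classical in
lemma leftOp_apply (x : MonoidAlgebra ℂ G) :
    leftOp G x = Matrix.toEuclideanLin (leftRegular x) := rfl

lemma leftOp_mul_apply (x y : MonoidAlgebra ℂ G) (v : EuclideanSpace ℂ G) :
    leftOp G (x * y) v = leftOp G x (leftOp G y v) := by
  classical
  rw [leftOp_apply, leftRegular_mul, Matrix.toLpLin_mul_same]
  rfl

lemma leftOp_one_apply (v : EuclideanSpace ℂ G) : leftOp G 1 v = v := by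
  classical
  have h : leftRegular (1 : MonoidAlgebra ℂ G) = 1 := by
    ext a b
    rw [leftRegular, Matrix.of_apply, MonoidAlgebra.one_def, MonoidAlgebra.coeff_single,
      Finsupp.single_apply, Matrix.one_apply]
    exact if_congr (by rw [eq_mul_inv_iff_mul_eq, one_mul, eq_comm]) rfl rfl
  rw [leftOp_apply, h, Matrix.toLpLin_one]
  rfl

lemma leftOp_injective (G : Type*) [Group G] [Fintype G] : Function.Injective (leftOp G) := by
  classical
  exact Matrix.toEuclideanLin.injective.comp (leftRegular_injective G)

lemma inner_leftOp (x y : MonoidAlgebra ℂ G) (v w : EuclideanSpace ℂ G) :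
    inner ℂ (leftOp G x v) (leftOp G y w) = inner ℂ v (leftOp G (star x * y) w) := by
  classical
  have h : leftOp G (star x) = LinearMap.adjoint (leftOp G x) := by
    rw [leftOp_apply, leftRegular_star, Matrix.toEuclideanLin_conjTranspose_eq_adjoint]
    rfl
  rw [leftOp_mul_apply, h, LinearMap.adjoint_inner_right]

lemma sum_inner_leftOp (x y : MonoidAlgebra ℂ G) {ι : Type*} [Fintype ι]
    (v : OrthonormalBasis ι ℂ (EuclideanSpace ℂ G)) :
    ∑ i, inner ℂ (leftOp G x (v i)) (leftOp G y (v i)) =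
      (Fintype.card G : ℂ) * ∑ k, star (x.coeff k) * y.coeff k := by
  classical
  simp only [inner_leftOp]
  rw [← LinearMap.trace_eq_sum_inner (leftOp G (star x * y)) v, ← coeff_one_star_mul,
    ← trace_leftRegular, leftOp_apply, Matrix.toEuclideanLin, Matrix.toLpLin_eq_toLin,
    Matrix.trace_toLin_eq]

lemma norm_leftOp_single (g : G) (v : EuclideanSpace ℂ G) :
    ‖leftOp G (MonoidAlgebra.single g 1) v‖ = ‖v‖ := by
  have h1 : star (MonoidAlgebra.single g (1 : ℂ)) * MonoidAlgebra.single g 1 = 1 := by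
    rw [star_single_one, MonoidAlgebra.single_mul_single, inv_mul_cancel, mul_one,
      MonoidAlgebra.one_def]
  have h2 := inner_leftOp (MonoidAlgebra.single g 1) (MonoidAlgebra.single g 1) v v
  rw [h1, leftOp_one_apply, inner_self_eq_norm_sq_to_K, inner_self_eq_norm_sq_to_K] at h2
  have h3 : ‖leftOp G (MonoidAlgebra.single g 1) v‖ ^ 2 = ‖v‖ ^ 2 := by exact_mod_cast h2
  exact (pow_left_inj₀ (norm_nonneg _) (norm_nonneg _) two_ne_zero).1 h3

lemma leftOp_eq_sum (x : MonoidAlgebra ℂ G) (v : EuclideanSpace ℂ G) :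
    leftOp G x v = ∑ g, x.coeff g • leftOp G (MonoidAlgebra.single g 1) v := by
  classical
  have h : x = ∑ g, x.coeff g • MonoidAlgebra.single g (1 : ℂ) := by
    refine ext_coeff fun k => ?_
    simp [MonoidAlgebra.coeff_sum]
  conv_lhs => rw [h, map_sum, LinearMap.sum_apply]
  exact Finset.sum_congr rfl fun g _ => by rw [map_smul, LinearMap.smul_apply]

lemma sum_sq_norm_leftOp (x : MonoidAlgebra ℂ G) {ι : Type*} [Fintype ι]
    (v : OrthonormalBasis ι ℂ (EuclideanSpace ℂ G)) :
    ∑ i, ‖leftOp G x (v i)‖ ^ 2 = Fintype.card G * ∑ k, ‖x.coeff k‖ ^ 2 := by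
  have h := sum_inner_leftOp x x v
  rw [← coeff_one_star_mul, coeff_one_star_mul_self] at h
  simp only [inner_self_eq_norm_sq_to_K] at h
  apply Complex.ofReal_injective
  rw [Complex.ofReal_sum, Complex.ofReal_mul, Complex.ofReal_natCast, ← h]
  exact Finset.sum_congr rfl fun i _ => Complex.ofReal_pow _ _

/-- If `x x⋆ x` is the multiple of `x` by `‖x‖₁²` and `|x|` is constant on its support, then `x` is
a multiple of a coset element. -/
lemma exists_cosetElement_of_flat {x : MonoidAlgebra ℂ G} (hx : x ≠ 0)
    {r : ℝ} (hr : ∀ g, x.coeff g ≠ 0 → ‖x.coeff g‖ = r)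
    (h : x * star x * x = (((∑ g, ‖x.coeff g‖) ^ 2 : ℝ) : ℂ) • x) :
    ∃ (H : Subgroup G) (χ : H →* ℂˣ) (g : G) (c : ℂ), c ≠ 0 ∧ x = c • cosetElement H χ g := by
  classical
  set s := ∑ g, ‖x.coeff g‖
  obtain ⟨k, hk⟩ : ∃ k, x.coeff k ≠ 0 := by
    by_contra! h0
    exact hx (ext_coeff h0)
  have hr0 : r ≠ 0 := by
    rw [← hr k hk]
    exact norm_ne_zero_iff.2 hk
  set S := Finset.univ.filter fun k => x.coeff k ≠ 0
  have hS0 : (S.card : ℝ) ≠ 0 := by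
    have : S.Nonempty := ⟨k, by simpa [S] using hk⟩
    exact_mod_cast this.card_pos.ne'
  have hs : s = S.card * r := by
    rw [← nsmul_eq_mul, ← Finset.sum_const, Finset.sum_filter]
    refine Finset.sum_congr rfl fun g _ => ?_
    by_cases hg : x.coeff g = 0
    · simp [hg]
    · rw [if_pos hg, hr g hg]
  have hs2 : ∑ g, ‖x.coeff g‖ ^ 2 = S.card * r ^ 2 := by
    rw [← nsmul_eq_mul, ← Finset.sum_const, Finset.sum_filter]
    refine Finset.sum_congr rfl fun g _ => ?_
    by_cases hg : x.coeff g = 0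
    · simp [hg]
    · rw [if_pos hg, hr g hg]
  have hsne : ((s ^ 2 : ℝ) : ℂ) ≠ 0 := by
    rw [hs]
    exact_mod_cast pow_ne_zero 2 (mul_ne_zero hS0 hr0)
  set p : MonoidAlgebra ℂ G := ((s ^ 2 : ℝ) : ℂ)⁻¹ • (x * star x) with hp
  have hpx : p * x = x := by
    rw [hp, smul_mul_assoc, h, smul_smul, inv_mul_cancel₀ hsne, one_smul]
  have hproj : IsStarProjection p := by
    refine ⟨?_, ?_⟩
    · rw [IsIdempotentElem]
      conv_lhs => rw [hp, mul_smul_comm, ← hp, ← mul_assoc, hpx]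
    · rw [IsSelfAdjoint, hp, star_smul_eq, star_mul, star_star]
      simp
  refine exists_cosetElement_of_projection_mul hproj hpx hx ?_
  have h1 : p.coeff 1 = ((s ^ 2 : ℝ) : ℂ)⁻¹ * ((∑ g, ‖x.coeff g‖ ^ 2 : ℝ) : ℂ) := by
    rw [hp, MonoidAlgebra.coeff_smul, Finsupp.smul_apply, smul_eq_mul, coeff_mul_eq_sum,
      Complex.ofReal_sum]
    congr 1
    refine Finset.sum_congr rfl fun g _ => ?_
    rw [coeff_star, mul_one, inv_inv, Complex.star_def, Complex.mul_conj,
      Complex.normSq_eq_norm_sq]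
  rw [h1, hs2, hs]
  have hr0' : (r : ℂ) ≠ 0 := by exact_mod_cast hr0
  have hS0' : (S.card : ℂ) ≠ 0 := by exact_mod_cast hS0
  push_cast
  field_simp
  rfl

theorem exists_cosetElement_of_isHirschmanBecknerMinimizer {x : MonoidAlgebra ℂ G}
    (h : IsHirschmanBecknerMinimizer x) :
    ∃ (H : Subgroup G) (χ : H →* ℂˣ) (g : G) (c : ℂ), c ≠ 0 ∧ x = c • cosetElement H χ g := by
  classical
  obtain ⟨hx, heq⟩ := h
  have hn : (0 : ℝ) < Fintype.card G := by exact_mod_cast Fintype.card_pos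
  rw [hirschmanBeckner_rhs hx, funEntropy_fourierAlg, algEntropy] at heq
  set hM := Matrix.isHermitian_conjTranspose_mul_self (leftRegular x)
  set t := hM.eigenvalues
  set v := hM.eigenvectorBasis
  have hMv : ∀ i, leftOp G (star x * x) (v i) = (t i : ℂ) • v i := fun i => by
    ext k
    have h1 := congrFun (hM.mulVec_eigenvectorBasis i) k
    have h2 : leftRegular (star x * x) = (leftRegular x).conjTranspose * leftRegular x := by
      rw [leftRegular_mul, leftRegular_star]
    rw [leftOp_apply, h2]
    exact h1
  have hnorm : ∀ i, ‖leftOp G x (v i)‖ ^ 2 = t i := fun i => by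
    have h1 := inner_leftOp x x (v i) (v i)
    rw [hMv, inner_smul_right, inner_self_eq_norm_sq_to_K, inner_self_eq_norm_sq_to_K,
      v.orthonormal.1 i] at h1
    simp only [RCLike.ofReal_one, one_pow, mul_one] at h1
    apply Complex.ofReal_injective
    rw [← h1]
    exact Complex.ofReal_pow _ _
  have ht : ∀ i, 0 ≤ t i := fun i => by
    rw [← hnorm i]
    positivity
  have hsqrt : ∀ i, Real.sqrt (t i) = ‖leftOp G x (v i)‖ := fun i => by
    rw [← hnorm i, Real.sqrt_sq (norm_nonneg _)]
  let b : G → G → ℂ := fun i g =>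
    inner ℂ (leftOp G x (v i)) (leftOp G (MonoidAlgebra.single g 1) (v i))
  have hsum : ∀ (w : MonoidAlgebra ℂ G) (i : G), ∑ g, w.coeff g * b i g =
      inner ℂ (leftOp G x (v i)) (leftOp G w (v i)) := fun w i => by
    rw [leftOp_eq_sum w, inner_sum]
    exact Finset.sum_congr rfl fun g _ => by rw [inner_smul_right]
  have hbx : ∀ i, ∑ g, x.coeff g * b i g = t i := fun i => by
    rw [hsum, inner_self_eq_norm_sq_to_K, ← hnorm i]
    norm_cast
  have hbi : ∀ g, ∑ i, b i g = ((Fintype.card G : ℝ) : ℂ) * star (x.coeff g) := fun g => by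
    have h1 := sum_inner_leftOp x (MonoidAlgebra.single g 1) v
    simpa [Finsupp.single_apply] using h1
  have hxb := mul_eq_of_entropy_eq hn ht (x := x.coeff) (b := b) (fun i g => ?_) hbx hbi ?_
    (sum_normSq_pos hx) ?_
  · obtain ⟨⟨r, hr⟩, hflat⟩ := flat_of_entropy_eq hn ht hbx hbi hxb
    refine exists_cosetElement_of_flat hx hr (leftOp_injective G (v.toBasis.ext fun i => ?_))
    rw [OrthonormalBasis.coe_toBasis, mul_assoc, leftOp_mul_apply, hMv, map_smul, map_smul,
      LinearMap.smul_apply]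
    by_cases hi : t i = 0
    · have h1 := hnorm i
      rw [hi, sq_eq_zero_iff, norm_eq_zero] at h1
      rw [h1, smul_zero, smul_zero]
    · rw [hflat i hi]
  · refine (norm_inner_le_norm _ _).trans ?_
    rw [norm_leftOp_single, v.orthonormal.1 i, mul_one, hsqrt]
  · intro e w he
    let y : MonoidAlgebra ℂ G := MonoidAlgebra.ofCoeff (Finsupp.equivFunOnFinite.symm w)
    have hy : ∀ g, w g = y.coeff g := fun g => rfl
    simp only [hy, hsum]
    rw [← sum_sq_norm_leftOp y v, ← Finset.sum_congr rfl fun i _ => hnorm i]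
    refine le_trans ?_ (Real.sum_mul_le_sqrt_mul_sqrt _ _ _)
    refine (norm_sum_le _ _).trans (Finset.sum_le_sum fun i _ => ?_)
    rw [norm_mul]
    refine (mul_le_of_le_one_left (norm_nonneg _) (he i)).trans (norm_inner_le_norm _ _)
  · simp only [Real.negMulLog, neg_mul, Finset.sum_neg_distrib] at heq
    linarith

end HirschmanBeckner

end GroupTwoBox

theorem proposition8 (G : Type*) [Group G] [Fintype G] :
    (∀ (H : Subgroup G) (χ : H →* ℂˣ) (g : G) (c : ℂ), c ≠ 0 →
      GroupTwoBox.IsAlgBishift (c • GroupTwoBox.cosetElement H χ g)) ∧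
    (∀ x : MonoidAlgebra ℂ G, GroupTwoBox.IsAlgBishift x →
      ∃ (H : Subgroup G) (χ : H →* ℂˣ) (g : G) (c : ℂ), c ≠ 0 ∧
        x = c • GroupTwoBox.cosetElement H χ g) ∧
    (∀ f : G → ℂ, GroupTwoBox.IsFunBishift f ↔
      ∃ (H : Subgroup G) (χ : H →* ℂˣ) (g : G) (c : ℂ), c ≠ 0 ∧
        f = c • GroupTwoBox.cosetFunction H χ g) ∧
    (∀ x : MonoidAlgebra ℂ G, GroupTwoBox.IsDonohoStarkMinimizer x ↔
      ∃ (H : Subgroup G) (χ : H →* ℂˣ) (g : G) (c : ℂ), c ≠ 0 ∧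
        x = c • GroupTwoBox.cosetElement H χ g) ∧
    (∀ x : MonoidAlgebra ℂ G, GroupTwoBox.IsHirschmanBecknerMinimizer x ↔
      ∃ (H : Subgroup G) (χ : H →* ℂˣ) (g : G) (c : ℂ), c ≠ 0 ∧
        x = c • GroupTwoBox.cosetElement H χ g) := by
  refine ⟨fun H χ g c hc => ?_, fun x => ?_, fun f => ?_, fun x => ?_, fun x => ⟨?_, ?_⟩⟩
  · exact GroupTwoBox.isAlgBishift_iff_exists_cosetElement.2 ⟨H, χ, g, c, hc, rfl⟩
  · exact GroupTwoBox.isAlgBishift_iff_exists_cosetElement.1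
  · exact GroupTwoBox.isFunBishift_iff_exists_cosetFunction
  · exact GroupTwoBox.isDonohoStarkMinimizer_iff_exists_cosetElement
  · exact GroupTwoBox.exists_cosetElement_of_isHirschmanBecknerMinimizer
  · rintro ⟨H, χ, g, c, hc, rfl⟩
    exact GroupTwoBox.isHirschmanBecknerMinimizer_cosetElement H χ g hc
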